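/- Let $G$ be a finite abelian group with dual group $\widehat G$ (the homomorphisms $G\to\mathbb{C}^\times$). A Bohr set $B=\mathrm{Bohr}(\Gamma,\rho)$ is given by a set $\Gamma\subset\widehat G$ and a radius $\rho\ge 0$; its underlying set is $\{x\in G: |\gamma(x)-1|\le\rho \text{ for all }\gamma\in\Gamma\}$, its rank is $\mathrm{rk}(B)=|\Gamma|$, and $B_\tau=\mathrm{Bohr}(\Gamma,\tau\rho)$. Write $\mathrm{Bohr}(\Lambda,\delta)\le\mathrm{Bohr}(\Gamma,\rho)$ if $\Lambda\supset\Gamma$ and $\delta\le\rho$. A Bohr set $B$ of rank $d$ is regular if $1-12d|\tau|\le |B_{1+\tau}|/|B|\le 1+12d|\tau|$ whenever $12d|\tau|\le 1$. If $|G|$ is odd, let $2\cdot B=\mathrm{Bohr}(\Gamma^{1/2},\rho)$, where $\Gamma^{1/2}=\{\chi\in\widehat G:\chi^2\in\Gamma\}$. For $A,A',A''\subset G$ let $2\cdot A=\{2x:x\in A\}$ and let $T(A,A',A'')$ be the number of $(x,y,z)\in A\times A'\times A''$ with $x+z=2y$. Let $1_A*\mu_T(x)=|T|^{-1}\sum_{t\in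 T}1_A(x-t)$ and $\|f\|_\infty=\max_{x\in G}|f(x)|$. There are absolute constants $c,C>0$ such that the following holds. Let $G$ be a finite abelian group of odd order, let $B$ be a regular Bohr set in $G$, and let $B'\le 2\cdot B$ be a regular Bohr set of rank $d$ and radius $\rho$ with $B'\subset B_{c/\mathrm{rk}(B)}$ as sets (if $\mathrm{rk}(B)=0$ this last condition is void). Let $\alpha>0$, and let $A\subset B$ and $A'\subset G$ with $2\cdot A'\subset B'$ satisfy $|A|\ge\alpha|B|$ and $|2\cdot A'|\ge\alpha|B'|$. Then either 1. $T(A,A',A)\ge\tfrac14\alpha|A||A'|$, or 2. there is a regular Bohr set $T\le B'$ of rank at most $d+C\alpha^{-1}\log(2/\alpha)^4$ and radius at least $c\,\min(\rho,2)\,\alpha^{C\log(2/\alpha)}/\max(d,1)^3$ such that $\|1_A*\mu_T\|_\infty\ge\tfrac32\alpha$. -/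

import Mathlib

noncomputable section

open scoped Classical in
/-- The set `{x ∈ G : |γ(x) - 1| ≤ ρ for all γ ∈ Γ}`. -/
def bohrFinset {G : Type*} [AddCommGroup G] [Fintype G]
    (Γ : Finset (AddChar G ℂ)) (ρ : ℝ) : Finset G :=
  Finset.univ.filter fun x => ∀ γ ∈ Γ, ‖γ x - 1‖ ≤ ρ

/-- A Bohr set, given by its defining data: a set of characters and a radius `ρ ≥ 0`. -/
structure BohrSet (G : Type*) [AddCommGroup G] [Fintype G] where
  /-- the set `Γ` of characters -/
  chars : Finset (AddChar G ℂ)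
  /-- the radius `ρ` -/
  radius : ℝ
  radius_nonneg : 0 ≤ radius

namespace BohrSet

variable {G : Type*} [AddCommGroup G] [Fintype G]

/-- The rank `|Γ|`. -/
def rank (B : BohrSet G) : ℕ := B.chars.card

/-- The underlying subset of `G`. -/
def toFinset (B : BohrSet G) : Finset G := bohrFinset B.chars B.radius

/-- The underlying set of the narrowed (or widened) Bohr set `B_τ`. -/
def scaled (B : BohrSet G) (τ : ℝ) : Finset G := bohrFinset B.chars (τ * B.radius)

/-- `B' ≤ B`: `B'` is a sub-Bohr set of `B`. -/
def IsSubBohr (B' B : BohrSet G) : Prop :=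
  B.chars ⊆ B'.chars ∧ B'.radius ≤ B.radius

/-- Regularity: `|B_{1+τ}| / |B|` is within `12d|τ|` of `1` whenever `12d|τ| ≤ 1`, where `d` is the
rank. (In rank `0` both sets are all of `G`, and the condition holds.) -/
def IsRegular (B : BohrSet G) : Prop :=
  ∀ τ : ℝ, 12 * (B.rank : ℝ) * |τ| ≤ 1 →
    1 - 12 * (B.rank : ℝ) * |τ| ≤ ((B.scaled (1 + τ)).card : ℝ) / (B.toFinset.card : ℝ) ∧
      ((B.scaled (1 + τ)).card : ℝ) / (B.toFinset.card : ℝ) ≤ 1 + 12 * (B.rank : ℝ) * |τ|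

open scoped Classical in
/-- The Bohr set `2 · B` with characters `Γ^{1/2}` and the same radius. When `G` has odd order,
squaring is a bijection of the dual group, so `Γ^{1/2}` is the set of `χ` with `χ ^ 2 ∈ Γ`. -/
def two (B : BohrSet G) : BohrSet G where
  chars := Finset.univ.filter fun χ => χ ^ 2 ∈ B.chars
  radius := B.radius
  radius_nonneg := B.radius_nonneg

end BohrSet

open scoped Classical in
/-- `2 · A = {2x : x ∈ A}`. -/
def twoDilate {G : Type*} [AddCommGroup G] (A : Finset G) : Finset G :=
  A.image fun x => 2 • x

/-- The relative density `|A| / |B|` of `A` in `B`. -/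
def relDensity {G : Type*} (A B : Finset G) : ℝ := (A.card : ℝ) / (B.card : ℝ)

open scoped Classical in
/-- The number `T(A, B, C)` of triples `(x, y, z) ∈ A × B × C` with `x + z = 2y`. -/
def threeAPCount {G : Type*} [AddCommGroup G] (A B C : Finset G) : ℕ :=
  ((A ×ˢ B ×ˢ C).filter fun p => p.1 + p.2.2 = 2 • p.2.1).card

/-- The indicator function `1_A`. -/
def indicatorFn {G : Type*} (A : Finset G) : G → ℝ :=
  Set.indicator (A : Set G) fun _ => 1

/-- The function `μ_A = 1_A / |A|`. -/
def muFn {G : Type*} (A : Finset G) : G → ℝ :=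
  fun x => indicatorFn A x / (A.card : ℝ)

/-- Convolution `f * g (x) = ∑ y, f y * g (x - y)`. -/
def conv {G : Type*} [AddCommGroup G] [Fintype G] (f g : G → ℝ) : G → ℝ :=
  fun x => ∑ y, f y * g (x - y)

/-- The supremum norm `sup_x |f x|` on a finite set. -/
def supNorm {G : Type*} [Fintype G] (f : G → ℝ) : ℝ := ⨆ x, |f x|

end

/-!
Write `E = -2·A'`. Then `T(A, A', A) = |A'| ∑_{x ∈ A} (1_A * μ_E)(-x)`, and the sum is to be
compared with `α |A|`. By the Croot–Sisask sampling argument, in `ℓ^{2p}` with `p ≈ log(1/α)` and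
relative to `1_A * μ_E + α`, the function `1_A * μ_E` is almost invariant under `X - X` for a
dense subset `X` of a narrow Bohr set. Hence it may be replaced by its smoothing with `k ≈
log(1/α)` copies of `μ_X * μ_{-X}`, whose Fourier transform is concentrated on the large spectrum
of `X`. By Chang's theorem relative to a Bohr set, few extra characters annihilate that spectrum,
so the smoothing is almost invariant under a regular Bohr set `T` of slightly larger rank, and a
further average over `T` costs nothing. If `1_A * μ_T ≤ 3α/2` everywhere, then `1_A * μ_T`, having
mean about `α` on `B`, has large self-convolution near `0`, which makes the sum at least `α |A| /
4`; otherwise `T` provides the density increment.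
-/

open Finset WithLp
open scoped BigOperators ComplexConjugate ENNReal Pointwise translate

/-! ### Convolutions and Fourier transforms -/

section Convolution

variable {G : Type*} [AddCommGroup G] [Fintype G]

lemma conv_comm (f g : G → ℝ) : conv f g = conv g f := by
  funext x
  unfold conv
  rw [← Equiv.sum_comp (Equiv.subLeft x)]
  simp [mul_comm]

lemma conv_apply' (f g : G → ℝ) (x : G) : conv f g x = ∑ y, g y * f (x - y) := by
  rw [conv_comm]; rfl

lemma conv_eq_sum_smul_translate (f g : G → ℝ) : conv f g = ∑ y, g y • τ y f := by
  funext x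
  simp [conv_apply']

lemma conv_assoc (f g h : G → ℝ) : conv (conv f g) h = conv f (conv g h) := by
  funext x
  simp only [conv, sum_mul, mul_sum]
  rw [sum_comm]
  refine sum_congr rfl fun y _ => ?_
  rw [← Equiv.sum_comp (Equiv.addRight y)]
  refine sum_congr rfl fun z _ => ?_
  simp only [Equiv.coe_addRight, add_sub_cancel_right]
  rw [sub_add_eq_sub_sub_swap, mul_assoc]

lemma conv_right_comm (f g h : G → ℝ) : conv (conv f g) h = conv (conv f h) g := by
  rw [conv_assoc, conv_comm g h, conv_assoc]

lemma sub_conv (f g h : G → ℝ) : conv (f - g) h = conv f h - conv g h := by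
  funext x
  simp [conv, sub_mul]

lemma sum_conv (f g : G → ℝ) : ∑ x, conv f g x = (∑ x, f x) * ∑ x, g x := by
  simp only [conv]
  rw [sum_comm, sum_mul]
  refine sum_congr rfl fun y _ => ?_
  rw [← mul_sum]
  congr 1
  exact (Equiv.subRight y).sum_comp g

lemma exists_add_eq_of_conv_ne_zero {f g : G → ℝ} {x : G} (h : conv f g x ≠ 0) :
    ∃ y z, f y ≠ 0 ∧ g z ≠ 0 ∧ y + z = x := by
  obtain ⟨y, -, hy⟩ := exists_ne_zero_of_sum_ne_zero h
  exact ⟨y, x - y, left_ne_zero_of_mul hy, right_ne_zero_of_mul hy, by abel⟩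

lemma conv_mem_stdSimplex {μ ν : G → ℝ} (hμ : μ ∈ stdSimplex ℝ G) (hν : ν ∈ stdSimplex ℝ G) :
    conv μ ν ∈ stdSimplex ℝ G :=
  ⟨fun _ => sum_nonneg fun _ _ => mul_nonneg (hμ.1 _) (hν.1 _),
    by rw [sum_conv, hμ.2, hν.2, mul_one]⟩

lemma conv_le_of_le {f μ : G → ℝ} {M : ℝ} (hμ : μ ∈ stdSimplex ℝ G) (hf : ∀ x, f x ≤ M) (x : G) :
    conv f μ x ≤ M := by
  rw [conv_apply']
  calc ∑ y, μ y * f (x - y) ≤ ∑ y, μ y * M :=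
        sum_le_sum fun y _ => mul_le_mul_of_nonneg_left (hf _) (hμ.1 y)
    _ = M := by rw [← sum_mul, hμ.2, one_mul]

lemma conv_sub_self_eq_sum {μ : G → ℝ} (hμ : μ ∈ stdSimplex ℝ G) (f : G → ℝ) :
    conv f μ - f = ∑ y, μ y • (τ y f - f) := by
  simp only [smul_sub, sum_sub_distrib, ← sum_smul, hμ.2, one_smul, conv_eq_sum_smul_translate]

end Convolution

section Averages

lemma norm_sum_smul_le_of_mem_stdSimplex {ι E : Type*} [Fintype ι] [SeminormedAddCommGroup E]
    [NormedSpace ℝ E] {μ : ι → ℝ} (hμ : μ ∈ stdSimplex ℝ ι) {v : ι → E} {η : ℝ}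
    (hv : ∀ i, μ i ≠ 0 → ‖v i‖ ≤ η) : ‖∑ i, μ i • v i‖ ≤ η := by
  calc ‖∑ i, μ i • v i‖ ≤ ∑ i, μ i * η := by
        refine norm_sum_le_of_le univ fun i _ => ?_
        rw [norm_smul_of_nonneg (hμ.1 i)]
        by_cases hi : μ i = 0
        · simp [hi]
        · exact mul_le_mul_of_nonneg_left (hv i hi) (hμ.1 i)
    _ = η := by rw [← sum_mul, hμ.2, one_mul]

variable {G : Type*} [AddCommGroup G] [Fintype G]

lemma abs_conv_sub_self_le {f μ : G → ℝ} {η : ℝ} (hμ : μ ∈ stdSimplex ℝ G) (x : G)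
    (hf : ∀ y, μ y ≠ 0 → |f (x - y) - f x| ≤ η) : |conv f μ x - f x| ≤ η := by
  have hsum : conv f μ x - f x = ∑ y, μ y • (f (x - y) - f x) := by
    simpa using congrFun (conv_sub_self_eq_sum hμ f) x
  rw [hsum]
  exact norm_sum_smul_le_of_mem_stdSimplex hμ (v := fun y => f (x - y) - f x) hf

end Averages

section LpNorm

lemma norm_toLp_pow {ι : Type*} [Fintype ι] {n : ℕ} (hn : n ≠ 0) (f : ι → ℝ) :
    ‖toLp (n : ℝ≥0∞) f‖ ^ n = ∑ i, |f i| ^ n := by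
  have hsum : 0 ≤ ∑ i, |f i| ^ n := sum_nonneg fun i _ => pow_nonneg (abs_nonneg _) n
  rw [PiLp.norm_eq_sum (by simpa [Nat.pos_iff_ne_zero] using hn)]
  simpa using Real.rpow_inv_natCast_pow hsum hn

lemma norm_toLp_le_iff {ι : Type*} [Fintype ι] {n : ℕ} [Fact (1 ≤ (n : ℝ≥0∞))] (hn : n ≠ 0)
    {f : ι → ℝ} {b : ℝ} (hb : 0 ≤ b) :
    ‖toLp (n : ℝ≥0∞) f‖ ≤ b ↔ ∑ i, |f i| ^ n ≤ b ^ n := by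
  rw [← norm_toLp_pow hn, pow_le_pow_iff_left₀ (norm_nonneg _) hb hn]

lemma norm_toLp_le_of_abs_le {ι : Type*} [Fintype ι] {n : ℕ} [Fact (1 ≤ (n : ℝ≥0∞))] (hn : n ≠ 0)
    {f g : ι → ℝ} (h : ∀ i, |f i| ≤ |g i|) : ‖toLp (n : ℝ≥0∞) f‖ ≤ ‖toLp (n : ℝ≥0∞) g‖ := by
  rw [norm_toLp_le_iff hn (norm_nonneg _), norm_toLp_pow hn]
  exact sum_le_sum fun i _ => pow_le_pow_left₀ (abs_nonneg _) (h i) n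

variable {G : Type*} [AddCommGroup G] [Fintype G] {p : ℝ≥0∞} [Fact (1 ≤ p)]

lemma norm_toLp_translate (f : G → ℝ) (t : G) : ‖toLp p (τ t f)‖ = ‖toLp p f‖ := by
  rw [← (LinearIsometryEquiv.piLpCongrLeft p ℝ ℝ (Equiv.addRight t)).norm_map (toLp p f)]
  congr 1
  ext x
  simp [LinearIsometryEquiv.piLpCongrLeft_apply, Equiv.piCongrLeft', sub_eq_add_neg]

lemma norm_toLp_conv_le {μ : G → ℝ} (hμ : μ ∈ stdSimplex ℝ G) (f : G → ℝ) :
    ‖toLp p (conv f μ)‖ ≤ ‖toLp p f‖ := by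
  rw [conv_eq_sum_smul_translate, toLp_sum]
  exact norm_sum_smul_le_of_mem_stdSimplex hμ (v := fun y => toLp p (τ y f))
    fun y _ => (norm_toLp_translate f y).le

lemma norm_toLp_conv_sub_self_le {μ : G → ℝ} (hμ : μ ∈ stdSimplex ℝ G) (f : G → ℝ) {η : ℝ}
    (hf : ∀ y, μ y ≠ 0 → ‖toLp p (τ y f - f)‖ ≤ η) : ‖toLp p (conv f μ - f)‖ ≤ η := by
  rw [conv_sub_self_eq_sum hμ, toLp_sum]
  exact norm_sum_smul_le_of_mem_stdSimplex hμ (v := fun y => toLp p (τ y f - f)) hf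

end LpNorm

section ConvIter

variable {G : Type*} [AddCommGroup G] [Fintype G]

/-- The iterated convolution `f * σ * ⋯ * σ` with `k` factors `σ`. -/
noncomputable def convIter (σ f : G → ℝ) (k : ℕ) : G → ℝ := (fun g => conv g σ)^[k] f

lemma convIter_succ (σ f : G → ℝ) (k : ℕ) :
    convIter σ f (k + 1) = conv (convIter σ f k) σ := Function.iterate_succ_apply' _ _ _

lemma conv_convIter (σ f g : G → ℝ) (k : ℕ) :
    conv g (convIter σ f k) = convIter σ (conv g f) k := by
  induction k with
  | zero => rfl
  | succ k ih => rw [convIter_succ, convIter_succ, ← conv_assoc, ih]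

lemma convIter_mem_stdSimplex {σ f : G → ℝ} (hσ : σ ∈ stdSimplex ℝ G) (hf : f ∈ stdSimplex ℝ G)
    (k : ℕ) : convIter σ f k ∈ stdSimplex ℝ G := by
  induction k with
  | zero => exact hf
  | succ k ih => rw [convIter_succ]; exact conv_mem_stdSimplex ih hσ

lemma norm_toLp_convIter_sub_self_le {p : ℝ≥0∞} [Fact (1 ≤ p)] {σ : G → ℝ}
    (hσ : σ ∈ stdSimplex ℝ G) (f : G → ℝ) (k : ℕ) :
    ‖toLp p (convIter σ f k - f)‖ ≤ k * ‖toLp p (conv f σ - f)‖ := by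
  induction k with
  | zero => simp [convIter]
  | succ k ih =>
    have hsplit : convIter σ f (k + 1) - f = conv (convIter σ f k - f) σ + (conv f σ - f) := by
      rw [convIter_succ, sub_conv, sub_add_sub_cancel]
    calc ‖toLp p (convIter σ f (k + 1) - f)‖
        ≤ ‖toLp p (conv (convIter σ f k - f) σ)‖ + ‖toLp p (conv f σ - f)‖ := by
          rw [hsplit, toLp_add]
          exact norm_add_le _ _
      _ ≤ ‖toLp p (convIter σ f k - f)‖ + ‖toLp p (conv f σ - f)‖ := by
          gcongr
          exact norm_toLp_conv_le hσ _
      _ ≤ (k + 1 : ℕ) * ‖toLp p (conv f σ - f)‖ := by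
          push_cast
          linarith

end ConvIter

section Indicator

variable {G : Type*} {A : Finset G} {x : G}

lemma indicatorFn_nonneg (A : Finset G) (x : G) : 0 ≤ indicatorFn A x :=
  Set.indicator_nonneg (fun _ _ => zero_le_one) x

lemma indicatorFn_of_mem (h : x ∈ A) : indicatorFn A x = 1 :=
  Set.indicator_of_mem (mem_coe.2 h) _

lemma indicatorFn_of_notMem (h : x ∉ A) : indicatorFn A x = 0 :=
  Set.indicator_of_notMem (mt mem_coe.1 h) _

lemma mem_of_indicatorFn_ne_zero (h : indicatorFn A x ≠ 0) : x ∈ A :=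
  not_imp_comm.1 indicatorFn_of_notMem h

lemma indicatorFn_le_one (A : Finset G) (x : G) : indicatorFn A x ≤ 1 :=
  Set.indicator_apply_le' (fun _ => le_rfl) fun _ => zero_le_one

lemma mem_of_muFn_ne_zero (h : muFn A x ≠ 0) : x ∈ A :=
  mem_of_indicatorFn_ne_zero (div_ne_zero_iff.1 h).1

variable [Fintype G]

lemma sum_indicatorFn_mul (A : Finset G) (f : G → ℝ) :
    ∑ x, indicatorFn A x * f x = ∑ x ∈ A, f x := by
  rw [← sum_subset (subset_univ A)]
  · exact sum_congr rfl fun x hx => by rw [indicatorFn_of_mem hx, one_mul]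
  · intro x _ hx
    rw [indicatorFn_of_notMem hx, zero_mul]

lemma sum_indicatorFn (A : Finset G) : ∑ x, indicatorFn A x = (A.card : ℝ) := by
  simpa using sum_indicatorFn_mul A fun _ => 1

lemma sum_muFn_mul (A : Finset G) (f : G → ℝ) :
    ∑ x, muFn A x * f x = (∑ x ∈ A, f x) / A.card := by
  rw [← sum_indicatorFn_mul A f, sum_div]
  exact sum_congr rfl fun x _ => by rw [muFn]; ring

lemma sum_muFn_sq (A : Finset G) : ∑ x, muFn A x ^ 2 = 1 / (A.card : ℝ) := by
  simp_rw [sq]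
  rw [sum_muFn_mul, sum_congr rfl fun x hx => by rw [muFn, indicatorFn_of_mem hx], sum_const,
    nsmul_eq_mul, mul_one_div, div_div, div_self_mul_self', one_div]

lemma muFn_mem_stdSimplex (hA : A.Nonempty) : muFn A ∈ stdSimplex ℝ G := by
  refine ⟨fun x => div_nonneg (indicatorFn_nonneg A x) (Nat.cast_nonneg _), ?_⟩
  have hA₀ : (A.card : ℝ) ≠ 0 := by exact_mod_cast hA.card_pos.ne'
  simpa [hA₀] using sum_muFn_mul A fun _ => 1

lemma conv_muFn_apply [AddCommGroup G] (f : G → ℝ) (E : Finset G) (x : G) :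
    conv f (muFn E) x = 𝔼 y ∈ E, f (x - y) := by
  rw [conv_apply', sum_muFn_mul E fun y => f (x - y), expect_eq_sum_div_card]

end Indicator

section Fourier

variable {G : Type*} [AddCommGroup G] [Fintype G]

/-- The Fourier transform of a real function, normalised as `∑ x, f x γ(x)`: no conjugate and no
factor `1 / |G|`, so that a probability mass function has transform bounded by `1`. -/
noncomputable def ft (f : G → ℝ) (γ : AddChar G ℂ) : ℂ := ∑ x, (f x : ℂ) * γ x

lemma ft_conv (f g : G → ℝ) (γ : AddChar G ℂ) : ft (conv f g) γ = ft f γ * ft g γ := by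
  simp only [ft, conv, Complex.ofReal_sum, sum_mul, Complex.ofReal_mul]
  rw [sum_comm]
  refine sum_congr rfl fun y _ => ?_
  rw [← Equiv.sum_comp (Equiv.addRight y), mul_sum]
  refine sum_congr rfl fun z _ => ?_
  simp only [Equiv.coe_addRight, add_sub_cancel_right, AddChar.map_add_eq_mul]
  ring

lemma ft_convIter (σ f : G → ℝ) (k : ℕ) (γ : AddChar G ℂ) :
    ft (convIter σ f k) γ = ft f γ * ft σ γ ^ k := by
  induction k with
  | zero => simp [convIter]
  | succ k ih => rw [convIter_succ, ft_conv, ih, pow_succ, mul_assoc]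

lemma ft_translate (f : G → ℝ) (t : G) (γ : AddChar G ℂ) : ft (τ t f) γ = γ t * ft f γ := by
  simp only [ft, mul_sum, translate_apply]
  rw [← Equiv.sum_comp (Equiv.addRight t)]
  refine sum_congr rfl fun z _ => ?_
  simp only [Equiv.coe_addRight, add_sub_cancel_right, AddChar.map_add_eq_mul]
  ring

lemma ft_sub (f g : G → ℝ) (γ : AddChar G ℂ) : ft (f - g) γ = ft f γ - ft g γ := by
  simp [ft, sub_mul]

lemma norm_ft_le_one {μ : G → ℝ} (hμ : μ ∈ stdSimplex ℝ G) (γ : AddChar G ℂ) : ‖ft μ γ‖ ≤ 1 := by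
  simp only [ft, ← Complex.real_smul]
  exact norm_sum_smul_le_of_mem_stdSimplex hμ fun x _ => (γ.norm_apply x).le

lemma norm_ft_neg (μ : G → ℝ) (γ : AddChar G ℂ) : ‖ft (fun x => μ (-x)) γ‖ = ‖ft μ γ‖ := by
  rw [← RCLike.norm_conj (ft μ γ)]
  congr 1
  simp only [ft, map_sum, map_mul, Complex.conj_ofReal, ← AddChar.map_neg_eq_conj]
  rw [← Equiv.sum_comp (Equiv.neg G)]
  simp

theorem sum_norm_ft_sq (f : G → ℝ) :
    ∑ γ : AddChar G ℂ, ‖ft f γ‖ ^ 2 = Fintype.card G * ∑ x, f x ^ 2 := by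
  classical
  have hsq (γ : AddChar G ℂ) :
      ((‖ft f γ‖ ^ 2 : ℝ) : ℂ) = ∑ x, ∑ y, (f x : ℂ) * f y * γ (x - y) := by
    rw [Complex.ofReal_pow, ← Complex.mul_conj', ft, map_sum, sum_mul_sum]
    refine sum_congr rfl fun x _ => sum_congr rfl fun y _ => ?_
    rw [map_mul, Complex.conj_ofReal, ← AddChar.map_neg_eq_conj, sub_eq_add_neg,
      AddChar.map_add_eq_mul]
    ring
  have horthogonal : ((∑ γ : AddChar G ℂ, ‖ft f γ‖ ^ 2 : ℝ) : ℂ)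
      = ((Fintype.card G * ∑ x, f x ^ 2 : ℝ) : ℂ) := by
    rw [Complex.ofReal_sum]
    simp_rw [hsq]
    rw [sum_comm]
    push_cast
    rw [mul_sum]
    refine sum_congr rfl fun x _ => ?_
    rw [sum_comm]
    simp_rw [← mul_sum, AddChar.sum_apply_eq_ite, sub_eq_zero]
    simp only [mul_ite, mul_zero, sum_ite_eq, mem_univ, if_true]
    ring
  exact_mod_cast horthogonal

end Fourier

/-! ### Bohr sets -/

section Characters

variable {G : Type*} [AddCommGroup G] [Finite G]

lemma norm_char_sub_sub_one (γ : AddChar G ℂ) (x y : G) : ‖γ (x - y) - 1‖ = ‖γ x - γ y‖ := by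
  have hfactor : γ x - γ y = (γ (x - y) - 1) * γ y := by
    rw [sub_mul, ← AddChar.map_add_eq_mul, sub_add_cancel, one_mul]
  rw [hfactor, norm_mul, AddChar.norm_apply, mul_one]

lemma norm_char_add_sub_one_le (γ : AddChar G ℂ) (x y : G) :
    ‖γ (x + y) - 1‖ ≤ ‖γ x - 1‖ + ‖γ y - 1‖ := by
  have hsplit : γ (x + y) - 1 = (γ x - 1) * γ y + (γ y - 1) := by
    rw [AddChar.map_add_eq_mul]; ring
  rw [hsplit]
  refine (norm_add_le _ _).trans ?_
  rw [norm_mul, AddChar.norm_apply, mul_one]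

lemma norm_char_neg_sub_one (γ : AddChar G ℂ) (x : G) : ‖γ (-x) - 1‖ = ‖γ x - 1‖ := by
  rw [← zero_sub, norm_char_sub_sub_one, AddChar.map_zero_eq_one, norm_sub_rev]

end Characters

section ComplexGrid

/-- The index of the cell containing `z` in the square grid of side `s⁻¹` in `ℂ`. -/
noncomputable def gridCell (s : ℝ) (z : ℂ) : ℤ × ℤ := (⌊z.re * s⌋, ⌊z.im * s⌋)

lemma floor_mem_Icc_of_abs_le {t : ℝ} {N : ℕ} (ht : |t| ≤ N) : ⌊t⌋ ∈ Icc (-N : ℤ) N := by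
  obtain ⟨hlow, hup⟩ := abs_le.1 ht
  rw [Finset.mem_Icc, Int.le_floor]
  refine ⟨by exact_mod_cast hlow, ?_⟩
  exact_mod_cast (Int.floor_le t).trans hup

lemma gridCell_mem {s : ℝ} (hs : 0 ≤ s) {z : ℂ} {N : ℕ} (hz : ‖z‖ * s ≤ N) :
    gridCell s z ∈ Icc (-N : ℤ) N ×ˢ Icc (-N : ℤ) N := by
  have hfloor {t : ℝ} (ht : |t| ≤ ‖z‖) : ⌊t * s⌋ ∈ Icc (-N : ℤ) N := by
    refine floor_mem_Icc_of_abs_le (le_trans ?_ hz)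
    rw [abs_mul, abs_of_nonneg hs]
    gcongr
  exact mem_product.2 ⟨hfloor (Complex.abs_re_le_norm z), hfloor (Complex.abs_im_le_norm z)⟩

lemma norm_sub_le_of_gridCell_eq {s : ℝ} (hs : 0 < s) {z w : ℂ} (h : gridCell s z = gridCell s w) :
    ‖z - w‖ ≤ 2 / s := by
  obtain ⟨hre, him⟩ := Prod.ext_iff.1 h
  have hfloor {t u : ℝ} (htu : ⌊t * s⌋ = ⌊u * s⌋) : |t - u| ≤ 1 / s := by
    have hlt := Int.abs_sub_lt_one_of_floor_eq_floor htu
    rw [← sub_mul, abs_mul, abs_of_pos hs] at hlt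
    exact (le_div_iff₀ hs).2 hlt.le
  calc ‖z - w‖ ≤ |(z - w).re| + |(z - w).im| := Complex.norm_le_abs_re_add_abs_im _
    _ ≤ 1 / s + 1 / s := by
        rw [Complex.sub_re, Complex.sub_im]
        exact add_le_add (hfloor hre) (hfloor him)
    _ = 2 / s := by ring

end ComplexGrid

section BohrBasic

variable {G : Type*} [AddCommGroup G] [Fintype G] {Γ Λ : Finset (AddChar G ℂ)} {ρ ρ' : ℝ} {x y : G}

lemma mem_bohrFinset : x ∈ bohrFinset Γ ρ ↔ ∀ γ ∈ Γ, ‖γ x - 1‖ ≤ ρ := by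
  classical
  simp [bohrFinset]

lemma zero_mem_bohrFinset (hρ : 0 ≤ ρ) : (0 : G) ∈ bohrFinset Γ ρ := by
  simp [mem_bohrFinset, hρ]

lemma bohrFinset_mono (hΓ : Γ ⊆ Λ) (hρ : ρ ≤ ρ') : bohrFinset Λ ρ ⊆ bohrFinset Γ ρ' :=
  fun _ hx => mem_bohrFinset.2 fun γ hγ => (mem_bohrFinset.1 hx γ (hΓ hγ)).trans hρ

lemma neg_mem_bohrFinset (hx : x ∈ bohrFinset Γ ρ) : -x ∈ bohrFinset Γ ρ :=
  mem_bohrFinset.2 fun γ hγ => (norm_char_neg_sub_one γ x).trans_le (mem_bohrFinset.1 hx γ hγ)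

lemma add_mem_bohrFinset (hx : x ∈ bohrFinset Γ ρ) (hy : y ∈ bohrFinset Γ ρ') :
    x + y ∈ bohrFinset Γ (ρ + ρ') :=
  mem_bohrFinset.2 fun γ hγ => (norm_char_add_sub_one_le γ x y).trans
    (add_le_add (mem_bohrFinset.1 hx γ hγ) (mem_bohrFinset.1 hy γ hγ))

lemma sub_mem_bohrFinset (hx : x ∈ bohrFinset Γ ρ) (hy : y ∈ bohrFinset Γ ρ') :
    x - y ∈ bohrFinset Γ (ρ + ρ') := by
  rw [sub_eq_add_neg]; exact add_mem_bohrFinset hx (neg_mem_bohrFinset hy)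

lemma card_bohrFinset_pos (hρ : 0 ≤ ρ) : 0 < (bohrFinset Γ ρ).card :=
  card_pos.2 ⟨0, zero_mem_bohrFinset hρ⟩

/-- Points of the Bohr set whose values `γ x - 1` lie in the same grid cells, for all `γ ∈ Γ`, have
their difference in the smaller Bohr set. -/
theorem card_bohrFinset_le_mul_card_div (hρ : 0 < ρ) {R : ℕ} (hR : 0 < R) :
    (bohrFinset Γ ρ).card ≤ (bohrFinset Γ (ρ / R)).card * ((4 * R + 1) ^ 2) ^ Γ.card := by
  classical
  have _hR' : (0 : ℝ) < R := by exact_mod_cast hR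
  set s : ℝ := 2 * R / ρ with hs
  have hs₀ : 0 < s := by positivity
  let cell : G → (Γ → ℤ × ℤ) := fun x γ => gridCell s (γ.1 x - 1)
  let I : Finset ℤ := Icc (-(2 * R : ℕ)) (2 * R : ℕ)
  have hmaps : ∀ x ∈ bohrFinset Γ ρ, cell x ∈ Fintype.piFinset fun _ : Γ => I ×ˢ I := by
    refine fun x hx => Fintype.mem_piFinset.2 fun γ => gridCell_mem hs₀.le ?_
    calc ‖γ.1 x - 1‖ * s ≤ ρ * s := by gcongr; exact mem_bohrFinset.1 hx γ γ.2
      _ = (2 * R : ℕ) := by rw [hs]; push_cast; field_simp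
  have hcard : (Fintype.piFinset fun _ : Γ => I ×ˢ I).card = ((4 * R + 1) ^ 2) ^ Γ.card := by
    have hI : I.card = 4 * R + 1 := by simp only [I, Int.card_Icc]; omega
    simp [Fintype.card_piFinset, hI, sq]
  rw [← hcard]
  refine card_le_mul_card_image_of_maps_to hmaps _ fun b _ => ?_
  rcases ({a ∈ bohrFinset Γ ρ | cell a = b} : Finset G).eq_empty_or_nonempty with h | ⟨x₀, hx₀⟩
  · rw [h]; simp
  refine card_le_card_of_injOn (fun x => x - x₀) (fun x hx => ?_) (sub_left_injective.injOn)
  refine mem_bohrFinset.2 fun γ hγ => ?_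
  have hcell : cell x = cell x₀ := (mem_filter.1 hx).2.trans (mem_filter.1 hx₀).2.symm
  have hclose := norm_sub_le_of_gridCell_eq hs₀ (congrFun hcell ⟨γ, hγ⟩)
  rw [sub_sub_sub_cancel_right] at hclose
  rw [norm_char_sub_sub_one]
  refine hclose.trans_eq ?_
  rw [hs]
  field_simp

end BohrBasic

section LipschitzPoint

open MeasureTheory Set

lemma ofReal_abs_sub_le_stieltjes_measure_uIcc {f : ℝ → ℝ} (hf : Monotone f) (x y : ℝ) :
    ENNReal.ofReal |f y - f x| ≤ hf.stieltjesFunction.measure (uIcc x y) := by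
  wlog hxy : x ≤ y generalizing x y
  · rw [abs_sub_comm, Set.uIcc_comm]
    exact this y x (le_of_not_ge hxy)
  rw [uIcc_of_le hxy, StieltjesFunction.measure_Icc, abs_of_nonneg (sub_nonneg.2 (hf hxy))]
  refine ENNReal.ofReal_le_ofReal (sub_le_sub (hf.le_rightLim le_rfl) ?_)
  refine le_of_tendsto (hf.stieltjesFunction.mono.tendsto_leftLim x) ?_
  filter_upwards [self_mem_nhdsWithin] with t ht
  exact hf.rightLim_le ht

lemma exists_disjoint_uIcc_subfamily {s : Set ℝ} {y : ℝ → ℝ} {h : ℝ}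
    (hne : ∀ x ∈ s, y x ≠ x) (hle : ∀ x ∈ s, |y x - x| ≤ h) :
    ∃ u ⊆ s, u.Countable ∧ u.PairwiseDisjoint (fun x => uIcc x (y x)) ∧
      volume s ≤ ∑' x : u, ENNReal.ofReal (3.1 * |y x - x|) := by
  obtain ⟨u, hus, hdisj, hcov⟩ := Vitali.exists_disjoint_subfamily_covering_enlargement
    (fun x => uIcc x (y x)) s (fun x => |y x - x|) 1.05 (by norm_num)
    (fun _ _ => abs_nonneg _) h hle (fun _ _ => nonempty_uIcc)
  have hcount : u.Countable := by
    refine hdisj.countable_of_nonempty_interior fun x hx => ?_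
    rw [Set.uIcc, interior_Icc, Set.nonempty_Ioo]
    exact inf_lt_sup.2 (hne x (hus hx)).symm
  refine ⟨u, hus, hcount, hdisj, ?_⟩
  set J : ℝ → Set ℝ := fun x =>
    Icc (min x (y x) - 1.05 * |y x - x|) (max x (y x) + 1.05 * |y x - x|) with hJ
  have hsJ : s ⊆ ⋃ x ∈ u, J x := by
    intro x hx
    obtain ⟨z, hz, ⟨w, hwx, hwz⟩, hlen⟩ := hcov x hx
    have hwx' := abs_le.1 ((abs_sub_left_of_mem_uIcc hwx).trans hlen)
    obtain ⟨hzw, hwz⟩ : min z (y z) ≤ w ∧ w ≤ max z (y z) := hwz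
    exact mem_iUnion₂.2 ⟨z, hz, by constructor <;> linarith [hwx'.1, hwx'.2]⟩
  have hvolJ (x : ℝ) : volume (J x) = ENNReal.ofReal (3.1 * |y x - x|) := by
    rw [hJ, Real.volume_Icc]
    congr 1
    have := max_sub_min_eq_abs x (y x)
    linarith
  calc volume s ≤ volume (⋃ x ∈ u, J x) := measure_mono hsJ
    _ ≤ ∑' x : u, volume (J x) := measure_biUnion_le _ hcount _
    _ = ∑' x : u, ENNReal.ofReal (3.1 * |y x - x|) := tsum_congr fun x => hvolJ x

/-- If every point of `[a, b]` failed, a Vitali subfamily of the offending intervals would carry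
more than the total increment of `f`. -/
theorem exists_lipschitz_point_of_monotone {f : ℝ → ℝ} (hf : Monotone f) {a b s h : ℝ}
    (hab : a ≤ b) (hh : 0 < h) (hs : 0 < s)
    (hlt : 3.1 * (f (b + 2 * h) - f (a - 2 * h)) < s * (b - a)) :
    ∃ x ∈ Icc a b, ∀ y, |y - x| ≤ h → |f y - f x| ≤ s * |y - x| := by
  by_contra! hcon
  choose! y hyx hyf using hcon
  have hne : ∀ x ∈ Icc a b, y x ≠ x := fun x hx h₀ => by simpa [h₀] using hyf x hx
  obtain ⟨u, hus, hcount, hdisj, hvol⟩ := exists_disjoint_uIcc_subfamily hne hyx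
  set m := hf.stieltjesFunction.measure
  have hunion : ⋃ x ∈ u, uIcc x (y x) ⊆ Ioc (a - 2 * h) (b + h) := by
    refine iUnion₂_subset fun x hx w hw => ?_
    have hwx := abs_le.1 ((abs_sub_left_of_mem_uIcc hw).trans (hyx x (hus hx)))
    obtain ⟨hax, hxb⟩ := hus hx
    exact ⟨by linarith [hwx.1], by linarith [hwx.2]⟩
  have hincr : ∑' x : u, ENNReal.ofReal (s * |y x - x|)
      ≤ ENNReal.ofReal (f (b + 2 * h) - f (a - 2 * h)) := by
    calc ∑' x : u, ENNReal.ofReal (s * |y x - x|) ≤ ∑' x : u, m (uIcc x.1 (y x)) :=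
          ENNReal.tsum_le_tsum fun x => (ENNReal.ofReal_le_ofReal (hyf x (hus x.2)).le).trans
            (ofReal_abs_sub_le_stieltjes_measure_uIcc hf _ _)
      _ = m (⋃ x ∈ u, uIcc x (y x)) :=
          (measure_biUnion hcount hdisj fun x _ => measurableSet_uIcc).symm
      _ ≤ m (Ioc (a - 2 * h) (b + h)) := measure_mono hunion
      _ ≤ ENNReal.ofReal (f (b + 2 * h) - f (a - 2 * h)) := by
          rw [StieltjesFunction.measure_Ioc]
          exact ENNReal.ofReal_le_ofReal
            (sub_le_sub (hf.rightLim_le (by linarith)) (hf.le_rightLim le_rfl))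
  have hlen : ENNReal.ofReal (s * (b - a))
      ≤ ENNReal.ofReal (3.1 * (f (b + 2 * h) - f (a - 2 * h))) := by
    calc ENNReal.ofReal (s * (b - a)) = ENNReal.ofReal s * volume (Icc a b) := by
          rw [Real.volume_Icc, ENNReal.ofReal_mul hs.le]
      _ ≤ ENNReal.ofReal s * ∑' x : u, ENNReal.ofReal (3.1 * |y x - x|) := by gcongr
      _ = ENNReal.ofReal 3.1 * ∑' x : u, ENNReal.ofReal (s * |y x - x|) := by
          rw [← ENNReal.tsum_mul_left, ← ENNReal.tsum_mul_left]
          refine tsum_congr fun x => ?_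
          rw [← ENNReal.ofReal_mul hs.le, ← ENNReal.ofReal_mul (by norm_num)]
          ring_nf
      _ ≤ ENNReal.ofReal (3.1 * (f (b + 2 * h) - f (a - 2 * h))) := by
          rw [ENNReal.ofReal_mul (by norm_num)]
          gcongr
  have hf₀ : f (a - 2 * h) ≤ f (b + 2 * h) := hf (by linarith)
  rw [ENNReal.ofReal_le_ofReal_iff (by linarith)] at hlen
  linarith

end LipschitzPoint

section Regular

variable {G : Type*} [AddCommGroup G] [Fintype G]

lemma isRegular_of_rank_eq_zero {B : BohrSet G} (hB : B.rank = 0) : B.IsRegular := by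
  have hall (ρ : ℝ) : bohrFinset B.chars ρ = univ := by
    ext x; simp [mem_bohrFinset, card_eq_zero.1 hB]
  intro κ _
  simp [hB, BohrSet.scaled, BohrSet.toFinset, hall]

lemma isRegular_of_radius_eq_zero {B : BohrSet G} (hB : B.radius = 0) : B.IsRegular := by
  intro κ _
  have hpos : ((bohrFinset B.chars 0).card : ℝ) ≠ 0 := by
    exact_mod_cast (card_bohrFinset_pos le_rfl).ne'
  simp only [BohrSet.scaled, BohrSet.toFinset, hB, mul_zero, div_self hpos]
  constructor <;> linarith [show 0 ≤ 12 * (B.rank : ℝ) * |κ| by positivity]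

/-- The logarithm of the size of `Bohr(Γ, e^a ρ)`. Regularity of this Bohr set is a Lipschitz
property of `logCardBohr Γ ρ` at `a`. -/
noncomputable def logCardBohr (Γ : Finset (AddChar G ℂ)) (ρ a : ℝ) : ℝ :=
  Real.log (bohrFinset Γ (Real.exp a * ρ)).card

variable {Γ : Finset (AddChar G ℂ)} {ρ : ℝ}

lemma exp_logCardBohr (hρ : 0 ≤ ρ) (a : ℝ) :
    Real.exp (logCardBohr Γ ρ a) = (bohrFinset Γ (Real.exp a * ρ)).card :=
  Real.exp_log (by exact_mod_cast card_bohrFinset_pos (by positivity))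

lemma monotone_logCardBohr (hρ : 0 ≤ ρ) : Monotone (logCardBohr Γ ρ) := by
  intro a b hab
  rw [← Real.exp_le_exp, exp_logCardBohr hρ, exp_logCardBohr hρ]
  exact_mod_cast card_le_card (bohrFinset_mono subset_rfl (by gcongr))

lemma logCardBohr_zero_sub_le (hρ : 0 < ρ) {R : ℕ} (hR : 0 < R) :
    logCardBohr Γ ρ 0 - logCardBohr Γ ρ (-Real.log R)
      ≤ Γ.card * (2 * Real.log (4 * R + 1)) := by
  have hR' : (0 : ℝ) < R := by exact_mod_cast hR
  rw [sub_le_iff_le_add, ← Real.exp_le_exp, Real.exp_add, exp_logCardBohr hρ.le,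
    exp_logCardBohr hρ.le, Real.exp_neg, Real.exp_log hR', Real.exp_zero, one_mul, Real.exp_nat_mul,
    ← Nat.cast_two, Real.exp_nat_mul, Real.exp_log (by positivity), mul_comm, ← div_eq_inv_mul]
  exact_mod_cast card_bohrFinset_le_mul_card_div hρ hR

lemma abs_log_one_add_le {κ : ℝ} (hκ : |κ| ≤ 1 / 12) : |Real.log (1 + κ)| ≤ 12 / 11 * |κ| := by
  obtain ⟨hlow, -⟩ := abs_le.1 hκ
  have hpos : 0 < 1 + κ := by linarith
  have hup : Real.log (1 + κ) ≤ κ := by linarith [Real.log_le_sub_one_of_pos hpos]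
  have hlog : κ / (1 + κ) ≤ Real.log (1 + κ) := by
    refine le_of_eq_of_le ?_ (Real.one_sub_inv_le_log_of_pos hpos)
    field_simp
    ring
  have hdiv : -(12 / 11 * |κ|) ≤ κ / (1 + κ) := by
    rw [le_div_iff₀ hpos]
    rcases abs_cases κ with ⟨h, _⟩ | ⟨h, _⟩ <;> rw [h] <;> nlinarith
  exact abs_le.2 ⟨hdiv.trans hlog, by linarith [le_abs_self κ, abs_nonneg κ]⟩

lemma abs_exp_sub_one_le_of_abs_le_mul_log_two {t u : ℝ} (ht : t ≤ 1)
    (hu : |u| ≤ t * Real.log 2) : |Real.exp u - 1| ≤ t := by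
  have hlog2 : 0 < Real.log 2 := Real.log_pos one_lt_two
  have ht₀ : 0 ≤ t := nonneg_of_mul_nonneg_left ((abs_nonneg u).trans hu) hlog2
  obtain ⟨hlow, hup⟩ := abs_le.1 hu
  have hconvex : Real.exp (t * Real.log 2) ≤ 1 + t := by
    have := convexOn_exp.2 (Set.mem_univ 0) (Set.mem_univ (Real.log 2)) (sub_nonneg.2 ht) ht₀
      (sub_add_cancel 1 t)
    simp only [smul_eq_mul, mul_zero, zero_add, Real.exp_zero, Real.exp_log two_pos] at this
    linarith
  have htangent := Real.add_one_le_exp u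
  have hlog2' : t * Real.log 2 ≤ t := mul_le_of_le_one_right ht₀ (by linarith [Real.log_two_lt_d9])
  exact abs_le.2 ⟨by linarith, by linarith [Real.exp_le_exp.2 hup]⟩

lemma isRegular_of_lipschitz (hρ : 0 ≤ ρ) (hΓ : Γ.Nonempty) {a : ℝ}
    (ha : ∀ b, |b - a| ≤ 1 / 11 →
      |logCardBohr Γ ρ b - logCardBohr Γ ρ a| ≤ 7.62 * Γ.card * |b - a|) :
    BohrSet.IsRegular ⟨Γ, Real.exp a * ρ, by positivity⟩ := by
  intro κ hκ
  simp only [BohrSet.rank, BohrSet.scaled, BohrSet.toFinset] at hκ ⊢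
  have hd : (1 : ℝ) ≤ Γ.card := by exact_mod_cast hΓ.card_pos
  have hκ' : |κ| ≤ 1 / 12 := by nlinarith [abs_nonneg κ]
  have hpos : 0 < 1 + κ := by linarith [(abs_le.1 hκ').1]
  set b : ℝ := a + Real.log (1 + κ) with hb
  have hba : |b - a| ≤ 12 / 11 * |κ| := by
    rw [hb, add_sub_cancel_left]; exact abs_log_one_add_le hκ'
  have hrad : (1 + κ) * (Real.exp a * ρ) = Real.exp b * ρ := by
    rw [hb, Real.exp_add, Real.exp_log hpos]; ring
  have hclose : |logCardBohr Γ ρ b - logCardBohr Γ ρ a|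
      ≤ 12 * (Γ.card : ℝ) * |κ| * Real.log 2 := by
    calc |logCardBohr Γ ρ b - logCardBohr Γ ρ a| ≤ 7.62 * Γ.card * |b - a| :=
          ha b (by linarith)
      _ ≤ 7.62 * Γ.card * (12 / 11 * |κ|) := by gcongr
      _ = 12 * Γ.card * |κ| * (7.62 / 11) := by ring
      _ ≤ 12 * Γ.card * |κ| * Real.log 2 := by
          gcongr
          linarith [Real.log_two_gt_d9]
  have hratio := abs_exp_sub_one_le_of_abs_le_mul_log_two hκ hclose
  rw [Real.exp_sub, exp_logCardBohr hρ, exp_logCardBohr hρ, ← hrad] at hratio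
  obtain ⟨hlow, hup⟩ := abs_le.1 hratio
  constructor <;> linarith

theorem exists_isRegular (Γ : Finset (AddChar G ℂ)) {ρ : ℝ} (hρ : 0 ≤ ρ) :
    ∃ B : BohrSet G, B.IsRegular ∧ B.chars = Γ ∧ ρ / 2 ^ 16 ≤ B.radius ∧ B.radius ≤ ρ := by
  rcases hρ.eq_or_lt with rfl | hρ₀
  · exact ⟨⟨Γ, 0, le_rfl⟩, isRegular_of_radius_eq_zero rfl, rfl, by simp, le_rfl⟩
  rcases Γ.eq_empty_or_nonempty with rfl | hΓ
  · exact ⟨⟨∅, ρ, hρ⟩, isRegular_of_rank_eq_zero rfl, rfl, div_le_self hρ (by norm_num), le_rfl⟩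
  have hd : (0 : ℝ) < Γ.card := by exact_mod_cast hΓ.card_pos
  have hlog2 := Real.log_two_gt_d9
  set L : ℝ := Real.log (2 ^ 16 : ℕ) with hL
  have hL' : L = 16 * Real.log 2 := by
    rw [hL, Nat.cast_pow, Real.log_pow]; norm_num
  have hgrow : logCardBohr Γ ρ 0 - logCardBohr Γ ρ (-L) ≤ Γ.card * (38 * Real.log 2) := by
    refine (logCardBohr_zero_sub_le hρ₀ (by norm_num)).trans ?_
    have hlog : Real.log (4 * (2 ^ 16 : ℕ) + 1) ≤ 19 * Real.log 2 := by
      calc Real.log (4 * (2 ^ 16 : ℕ) + 1) ≤ Real.log (2 ^ 19) :=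
            Real.log_le_log (by positivity) (by norm_num)
        _ = 19 * Real.log 2 := by rw [Real.log_pow]; norm_num
    exact mul_le_mul_of_nonneg_left (by linarith) hd.le
  obtain ⟨a, ⟨haL, ha₀⟩, ha⟩ := exists_lipschitz_point_of_monotone
    (monotone_logCardBohr (Γ := Γ) hρ) (a := -L + 2 / 11) (b := -2 / 11) (s := 7.62 * Γ.card)
    (h := 1 / 11) (by linarith) (by norm_num) (by positivity) (by
      rw [show (-2 / 11 + 2 * (1 / 11) : ℝ) = 0 by norm_num,
        show (-L + 2 / 11 - 2 * (1 / 11) : ℝ) = -L by ring]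
      have : Γ.card * (117.8 * Real.log 2) < Γ.card * (7.62 * (L - 4 / 11)) :=
        mul_lt_mul_of_pos_left (by linarith) hd
      linarith)
  refine ⟨_, isRegular_of_lipschitz hρ hΓ ha, rfl, ?_, ?_⟩
  · calc ρ / 2 ^ 16 = Real.exp (-L) * ρ := by
          rw [Real.exp_neg, hL, Real.exp_log (by positivity), ← div_eq_inv_mul]; norm_num
      _ ≤ Real.exp a * ρ := by gcongr; linarith
  · exact mul_le_of_le_one_left hρ (Real.exp_le_one_iff.2 (by linarith))

lemma BohrSet.IsRegular.card_le {B : BohrSet G} (hB : B.IsRegular) {κ r : ℝ} (hκ₀ : 0 ≤ κ)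
    (hκ : 12 * (B.rank : ℝ) * κ ≤ 1) (hr : r ≤ (1 + κ) * B.radius) :
    ((bohrFinset B.chars r).card : ℝ) ≤ (1 + 12 * (B.rank : ℝ) * κ) * B.toFinset.card := by
  have h := (hB κ (by rwa [abs_of_nonneg hκ₀])).2
  rw [abs_of_nonneg hκ₀, div_le_iff₀ (by exact_mod_cast card_bohrFinset_pos B.radius_nonneg)] at h
  refine le_trans ?_ h
  exact_mod_cast card_le_card (bohrFinset_mono subset_rfl hr)

lemma BohrSet.IsRegular.card_scaled_le_two_mul {B : BohrSet G} (hB : B.IsRegular) {κ : ℝ}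
    (hκ₀ : 0 ≤ κ) (hκ : 12 * (B.rank : ℝ) * κ ≤ 1) :
    ((B.scaled (1 + κ)).card : ℝ) ≤ 2 * B.toFinset.card := by
  refine (hB.card_le hκ₀ hκ le_rfl).trans ?_
  gcongr
  linarith

lemma BohrSet.IsRegular.le_card {B : BohrSet G} (hB : B.IsRegular) {κ r : ℝ} (hκ₀ : 0 ≤ κ)
    (hκ : 12 * (B.rank : ℝ) * κ ≤ 1) (hr : (1 - κ) * B.radius ≤ r) :
    (1 - 12 * (B.rank : ℝ) * κ) * B.toFinset.card ≤ ((bohrFinset B.chars r).card : ℝ) := by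
  have h := (hB (-κ) (by rwa [abs_neg, abs_of_nonneg hκ₀])).1
  rw [abs_neg, abs_of_nonneg hκ₀,
    le_div_iff₀ (by exact_mod_cast card_bohrFinset_pos B.radius_nonneg)] at h
  refine h.trans ?_
  exact_mod_cast card_le_card (bohrFinset_mono subset_rfl (by linarith))

end Regular

/-! ### Almost-periods of convolutions -/

section Moments

variable {ι : Type*} {E : Finset ι} {v : ι → ℝ} {t : ℝ}

lemma sum_exp_centred_le (hv₀ : ∀ a ∈ E, 0 ≤ v a) (hv₁ : ∀ a ∈ E, v a ≤ 1) (ht : |t| ≤ 1) :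
    ∑ a ∈ E, Real.exp (t * (v a - 𝔼 b ∈ E, v b))
      ≤ E.card * Real.exp (t ^ 2 * 𝔼 b ∈ E, v b) := by
  rcases E.eq_empty_or_nonempty with rfl | hE
  · simp
  set q := 𝔼 b ∈ E, v b
  have hsum : ∑ a ∈ E, v a = E.card * q := by rw [← nsmul_eq_mul, card_smul_expect]
  have hq₀ : 0 ≤ q := expect_nonneg hv₀
  have hq₁ : q ≤ 1 := expect_le hE hv₁
  have htaylor (a) (ha : a ∈ E) : Real.exp (t * (v a - q))
      ≤ (1 - t * q + t ^ 2 * q ^ 2) + (t + t ^ 2 * (1 - 2 * q)) * v a := by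
    have hle : |t * (v a - q)| ≤ 1 := by
      rw [abs_mul]
      refine mul_le_one₀ ht (abs_nonneg _) (abs_le.2 ⟨?_, ?_⟩) <;> linarith [hv₀ a ha, hv₁ a ha]
    have hexp := (abs_le.1 (Real.abs_exp_sub_one_sub_id_le hle)).2
    have hsq : v a ^ 2 ≤ v a := by nlinarith [hv₀ a ha, hv₁ a ha]
    nlinarith [sq_nonneg t]
  calc ∑ a ∈ E, Real.exp (t * (v a - q))
      ≤ ∑ a ∈ E, ((1 - t * q + t ^ 2 * q ^ 2) + (t + t ^ 2 * (1 - 2 * q)) * v a) :=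
        sum_le_sum htaylor
    _ = E.card * (1 + t ^ 2 * (q - q ^ 2)) := by
        rw [sum_add_distrib, ← mul_sum, hsum, sum_const, nsmul_eq_mul]
        ring
    _ ≤ E.card * Real.exp (t ^ 2 * q) := by
        gcongr
        linarith [Real.add_one_le_exp (t ^ 2 * q), mul_nonneg (sq_nonneg t) (sq_nonneg q)]

lemma sum_piFinset_exp_centred_le (hv₀ : ∀ a ∈ E, 0 ≤ v a) (hv₁ : ∀ a ∈ E, v a ≤ 1)
    (ht : |t| ≤ 1) (m : ℕ) :
    ∑ a ∈ Fintype.piFinset fun _ : Fin m => E, Real.exp (t * ∑ i, (v (a i) - 𝔼 b ∈ E, v b))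
      ≤ (E.card : ℝ) ^ m * Real.exp (m * (t ^ 2 * 𝔼 b ∈ E, v b)) := by
  calc _ = (∑ a ∈ E, Real.exp (t * (v a - 𝔼 b ∈ E, v b))) ^ m := by
        simp only [mul_sum, Real.exp_sum]
        rw [← prod_univ_sum (fun _ : Fin m => E) fun _ a =>
          Real.exp (t * (v a - 𝔼 b ∈ E, v b))]
        simp
    _ ≤ (E.card * Real.exp (t ^ 2 * 𝔼 b ∈ E, v b)) ^ m :=
        pow_le_pow_left₀ (sum_nonneg fun a _ => (Real.exp_pos _).le)
          (sum_exp_centred_le hv₀ hv₁ ht) m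
    _ = _ := by rw [mul_pow, Real.exp_nat_mul]

lemma abs_pow_le_factorial_mul_exp_add_exp_neg (x : ℝ) (n : ℕ) :
    |x| ^ n ≤ n.factorial * (Real.exp x + Real.exp (-x)) := by
  calc |x| ^ n ≤ n.factorial * Real.exp |x| := by
        rw [← div_le_iff₀' (by positivity)]
        exact Real.pow_div_factorial_le_exp |x| (abs_nonneg x) n
    _ ≤ n.factorial * (Real.exp x + Real.exp (-x)) := by
        gcongr
        rcases abs_choice x with h | h <;> rw [h] <;> linarith [Real.exp_pos x, Real.exp_pos (-x)]

lemma pow_mul_sum_piFinset_abs_centred_pow_le (hv₀ : ∀ a ∈ E, 0 ≤ v a) (hv₁ : ∀ a ∈ E, v a ≤ 1)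
    (ht₀ : 0 ≤ t) (ht₁ : t ≤ 1) (m n : ℕ) :
    t ^ n * ∑ a ∈ Fintype.piFinset fun _ : Fin m => E, |∑ i, (v (a i) - 𝔼 b ∈ E, v b)| ^ n
      ≤ n.factorial * (2 * ((E.card : ℝ) ^ m * Real.exp (m * (t ^ 2 * 𝔼 b ∈ E, v b)))) := by
  have hpos := sum_piFinset_exp_centred_le hv₀ hv₁ (t := t) (by rwa [abs_of_nonneg ht₀]) m
  have hneg := sum_piFinset_exp_centred_le hv₀ hv₁ (t := -t)
    (by rwa [abs_neg, abs_of_nonneg ht₀]) m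
  rw [neg_sq] at hneg
  calc t ^ n * ∑ a ∈ Fintype.piFinset fun _ : Fin m => E, |∑ i, (v (a i) - 𝔼 b ∈ E, v b)| ^ n
      = ∑ a ∈ Fintype.piFinset fun _ : Fin m => E,
          |t * ∑ i, (v (a i) - 𝔼 b ∈ E, v b)| ^ n := by
        rw [mul_sum]
        exact sum_congr rfl fun a _ => by rw [abs_mul, mul_pow, abs_of_nonneg ht₀]
    _ ≤ ∑ a ∈ Fintype.piFinset fun _ : Fin m => E,
          n.factorial * (Real.exp (t * ∑ i, (v (a i) - 𝔼 b ∈ E, v b))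
            + Real.exp (-t * ∑ i, (v (a i) - 𝔼 b ∈ E, v b))) := by
        refine sum_le_sum fun a _ => ?_
        rw [neg_mul]
        exact abs_pow_le_factorial_mul_exp_add_exp_neg _ n
    _ ≤ _ := by
        rw [← mul_sum, sum_add_distrib]
        gcongr
        linarith

lemma factorial_two_mul_mul_exp_le {p : ℕ} (hp : p ≠ 0) :
    ((2 * p).factorial : ℝ) * (2 * Real.exp p) ≤ (22 * (p : ℝ) ^ 2) ^ p := by
  have hfactorial : ((2 * p).factorial : ℝ) ≤ (4 * (p : ℝ) ^ 2) ^ p := by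
    calc ((2 * p).factorial : ℝ) ≤ ((2 * p : ℕ) : ℝ) ^ (2 * p) := by
          exact_mod_cast Nat.factorial_le_pow (2 * p)
      _ = (4 * (p : ℝ) ^ 2) ^ p := by rw [pow_mul]; push_cast; ring
  have hexp : Real.exp p ≤ (2.75 : ℝ) ^ p := by
    rw [← mul_one (p : ℝ), Real.exp_nat_mul]
    gcongr
    linarith [Real.exp_one_lt_d9]
  calc _ ≤ (4 * (p : ℝ) ^ 2) ^ p * (2 ^ p * 2.75 ^ p) := by
        gcongr
        exact le_self_pow₀ one_le_two hp
    _ = _ := by rw [← mul_pow, ← mul_pow]; congr 1; ring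

lemma abs_sum_div_sub_pow_eq {m : ℕ} (hm : m ≠ 0) (w : Fin m → ℝ) (q : ℝ) (n : ℕ) :
    |(∑ i, w i) / m - q| ^ n = |∑ i, (w i - q)| ^ n / (m : ℝ) ^ n := by
  have hm' : (m : ℝ) ≠ 0 := by exact_mod_cast hm
  rw [← div_pow, ← Nat.abs_cast m, ← abs_div, Nat.abs_cast, sum_sub_distrib, sub_div]
  simp [hm']

lemma sum_piFinset_abs_mean_sub_pow_le (hv₀ : ∀ a ∈ E, 0 ≤ v a) (hv₁ : ∀ a ∈ E, v a ≤ 1)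
    {α θ : ℝ} (hα : 0 < α) (hθ₀ : 0 < θ) (hθ₁ : θ ≤ 1) {p m : ℕ} (hp : p ≠ 0)
    (hm : 22 * p ≤ m * (θ ^ 2 * α)) :
    ∑ a ∈ Fintype.piFinset fun _ : Fin m => E, |(∑ i, v (a i)) / m - 𝔼 b ∈ E, v b| ^ (2 * p)
      ≤ (E.card : ℝ) ^ m * (θ * (𝔼 b ∈ E, v b + α)) ^ (2 * p) := by
  have hp₀ : (0 : ℝ) < p := by exact_mod_cast Nat.pos_of_ne_zero hp
  have hm₀ : (0 : ℝ) < m := pos_of_mul_pos_left (b := θ ^ 2 * α) (by linarith) (by positivity)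
  have hq₀ : 0 ≤ 𝔼 b ∈ E, v b := expect_nonneg hv₀
  set q := 𝔼 b ∈ E, v b
  have hQ₀ : 0 < q + α := by positivity
  have hmQ : 22 * (p : ℝ) ≤ m * (θ ^ 2 * (q + α)) := hm.trans (by gcongr; linarith)
  set t := Real.sqrt (p / (m * (q + α))) with ht
  have ht₀ : 0 < t := Real.sqrt_pos.2 (by positivity)
  have ht_sq : t ^ 2 = p / (m * (q + α)) := Real.sq_sqrt (by positivity)
  have ht₁ : t ≤ 1 := by
    rw [ht, Real.sqrt_le_one, div_le_one (by positivity)]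
    calc (p : ℝ) ≤ m * (θ ^ 2 * (q + α)) := by linarith
      _ ≤ m * (1 * (q + α)) := by gcongr; exact pow_le_one₀ hθ₀.le hθ₁
      _ = m * (q + α) := by rw [one_mul]
  have hexponent : (m : ℝ) * (t ^ 2 * q) ≤ p := by
    rw [ht_sq, show (m : ℝ) * (p / (m * (q + α)) * q) = p * (q / (q + α)) by field_simp]
    exact mul_le_of_le_one_right hp₀.le ((div_le_one hQ₀).2 (by linarith))
  have hbase : 22 * (p : ℝ) ^ 2 ≤ t ^ 2 * (θ * (q + α)) ^ 2 * m ^ 2 := by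
    rw [ht_sq, show (p : ℝ) / (m * (q + α)) * (θ * (q + α)) ^ 2 * m ^ 2
      = p * (m * (θ ^ 2 * (q + α))) by field_simp]
    nlinarith
  simp_rw [abs_sum_div_sub_pow_eq (Nat.cast_pos.1 hm₀).ne']
  rw [← sum_div, div_le_iff₀ (by positivity)]
  refine le_of_mul_le_mul_left ?_ (show 0 < t ^ (2 * p) by positivity)
  calc _ ≤ ((2 * p).factorial : ℝ) * (2 * ((E.card : ℝ) ^ m * Real.exp (m * (t ^ 2 * q)))) :=
        pow_mul_sum_piFinset_abs_centred_pow_le hv₀ hv₁ ht₀.le ht₁ m (2 * p)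
    _ ≤ ((2 * p).factorial : ℝ) * (2 * ((E.card : ℝ) ^ m * Real.exp p)) := by gcongr
    _ = (E.card : ℝ) ^ m * (((2 * p).factorial : ℝ) * (2 * Real.exp p)) := by ring
    _ ≤ (E.card : ℝ) ^ m * (t ^ 2 * (θ * (q + α)) ^ 2 * m ^ 2) ^ p := by
        gcongr
        exact (factorial_two_mul_mul_exp_le hp).trans (by gcongr)
    _ = _ := by rw [mul_pow, mul_pow, ← pow_mul, ← pow_mul, ← pow_mul]; ring

end Moments

section AlmostPeriods

variable {G : Type*} [AddCommGroup G]

/-- The empirical mean of the `m` translates of `f` by a sample `a`. -/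
noncomputable def sampleMean {m : ℕ} (f : G → ℝ) (a : Fin m → G) (x : G) : ℝ :=
  (∑ i, f (x - a i)) / m

lemma sampleMean_translate {m : ℕ} (f : G → ℝ) (a : Fin m → G) (s : G) :
    τ s (sampleMean f a) = sampleMean f fun i => a i + s := by
  funext x
  simp [sampleMean, sub_sub, add_comm s]

/-- Pigeonhole on `a + s ∈ (E + S)ᵐ`: a dense family of samples has many translates in common. -/
lemma exists_large_subset_of_card_add_le [DecidableEq G] {E S : Finset G} (hE : E.Nonempty)
    (hS : S.Nonempty) {K : ℝ} (hK : ((E + S).card : ℝ) ≤ K * E.card) {m : ℕ}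
    {Y : Finset (Fin m → G)} (hYE : ∀ a ∈ Y, ∀ i, a i ∈ E)
    (hY : (E.card : ℝ) ^ m ≤ 2 * Y.card) :
    ∃ (b : Fin m → G) (X : Finset G), X ⊆ S ∧ (S.card : ℝ) ≤ 2 * K ^ m * X.card ∧
      ∀ s ∈ X, (fun i => b i - s) ∈ Y := by
  set W := Fintype.piFinset fun _ : Fin m => E + S with hW
  have hcardW : (W.card : ℝ) = ((E + S).card : ℝ) ^ m := by simp [hW, Fintype.card_piFinset]
  have hW₀ : (0 : ℝ) < ((E + S).card : ℝ) ^ m :=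
    pow_pos (by exact_mod_cast (hE.add hS).card_pos) m
  have hE₀ : (0 : ℝ) < (E.card : ℝ) ^ m := pow_pos (by exact_mod_cast hE.card_pos) m
  obtain ⟨b, -, hb⟩ := exists_le_card_fiber_of_nsmul_le_card_of_maps_to
    (s := Y ×ˢ S) (t := W) (f := fun r i => r.1 i + r.2)
    (b := (Y.card : ℝ) * S.card / ((E + S).card : ℝ) ^ m)
    (fun r hr => Fintype.mem_piFinset.2 fun i =>
      add_mem_add (hYE _ (mem_product.1 hr).1 i) (mem_product.1 hr).2)
    (card_pos.1 (by rw [← hcardW] at hW₀; exact_mod_cast hW₀))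
    (by rw [nsmul_eq_mul, hcardW, card_product, Nat.cast_mul, mul_div_cancel₀ _ hW₀.ne'])
  refine ⟨b, S.filter fun s => (fun i => b i - s) ∈ Y, filter_subset _ _, ?_,
    fun s hs => (mem_filter.1 hs).2⟩
  set X := S.filter fun s => (fun i => b i - s) ∈ Y
  have hfibre : ((Y ×ˢ S).filter fun r => (fun i => r.1 i + r.2) = b).card ≤ X.card := by
    refine card_le_card_of_injOn Prod.snd (fun r hr => ?_) fun r hr r' hr' h => ?_
    · obtain ⟨hYS, rfl⟩ := mem_filter.1 (mem_coe.1 hr)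
      exact mem_filter.2 ⟨(mem_product.1 hYS).2, by simpa using (mem_product.1 hYS).1⟩
    · have heq := (mem_filter.1 hr).2.trans (mem_filter.1 hr').2.symm
      refine Prod.ext (funext fun i => add_right_cancel (b := r.2) ?_) h
      simpa [h] using congrFun heq i
  rw [div_le_iff₀ hW₀] at hb
  refine le_of_mul_le_mul_left ?_ hE₀
  calc (E.card : ℝ) ^ m * S.card ≤ 2 * Y.card * S.card := by gcongr
    _ = 2 * (Y.card * S.card) := by ring
    _ ≤ 2 * (X.card * (K * E.card) ^ m) := by
        refine mul_le_mul_of_nonneg_left (hb.trans ?_) zero_le_two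
        gcongr
    _ = (E.card : ℝ) ^ m * (2 * K ^ m * X.card) := by rw [mul_pow]; ring

variable [Fintype G]

lemma sum_piFinset_abs_sampleMean_sub_conv_pow_le {f : G → ℝ} (hf₀ : ∀ x, 0 ≤ f x)
    (hf₁ : ∀ x, f x ≤ 1) {E P : Finset G} (hP : ∀ x, conv f (muFn E) x ≠ 0 → x ∈ P)
    {α θ : ℝ} (hα : 0 < α) (hθ₀ : 0 < θ) (hθ₁ : θ ≤ 1) {p m : ℕ} (hp : p ≠ 0)
    (hm : 22 * p ≤ m * (θ ^ 2 * α)) (x : G) :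
    ∑ a ∈ Fintype.piFinset fun _ : Fin m => E,
        |sampleMean f a x - conv f (muFn E) x| ^ (2 * p)
      ≤ (E.card : ℝ) ^ m *
        (θ ^ (2 * p) * |indicatorFn P x * (conv f (muFn E) x + α)| ^ (2 * p)) := by
  have hconv := conv_muFn_apply f E x
  have hnonneg : 0 ≤ conv f (muFn E) x := hconv ▸ expect_nonneg fun y _ => hf₀ _
  by_cases hx : x ∈ P
  · rw [indicatorFn_of_mem hx, one_mul, abs_of_nonneg (by positivity), ← mul_pow, hconv]
    exact sum_piFinset_abs_mean_sub_pow_le (fun y _ => hf₀ (x - y)) (fun y _ => hf₁ (x - y))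
      hα hθ₀ hθ₁ hp hm
  · have hzero : conv f (muFn E) x = 0 := not_imp_comm.1 (hP x) hx
    have hvanish : ∀ y ∈ E, f (x - y) = 0 :=
      (expect_eq_zero_iff_of_nonneg fun y _ => hf₀ (x - y)).1 (hconv.symm.trans hzero)
    refine (sum_eq_zero fun a ha => ?_).trans_le (by positivity)
    rw [hzero, sampleMean, sum_eq_zero fun i _ => hvanish _ (Fintype.mem_piFinset.1 ha i)]
    simp [hp]

lemma card_le_two_mul_card_filter_le {κ : Type*} {Ω : Finset κ} {N : κ → ℝ} (hN : ∀ a, 0 ≤ N a)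
    {V : ℝ} (hV : 0 < V) {n : ℕ} (hn : n ≠ 0) (hsum : ∑ a ∈ Ω, N a ^ n ≤ Ω.card * V ^ n) :
    Ω.card ≤ 2 * (Ω.filter fun a => N a ≤ 2 * V).card := by
  have hbad : ((Ω.filter fun a => ¬N a ≤ 2 * V).card : ℝ) * (2 * V) ^ n ≤ Ω.card * V ^ n := by
    rw [← nsmul_eq_mul]
    refine (card_nsmul_le_sum _ (fun a => N a ^ n) _ fun a ha => ?_).trans
      ((sum_le_sum_of_subset_of_nonneg (filter_subset _ _)
        fun a _ _ => pow_nonneg (hN a) n).trans hsum)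
    exact pow_le_pow_left₀ (by positivity) (not_le.1 (mem_filter.1 ha).2).le n
  rw [mul_pow, ← mul_assoc] at hbad
  have htwo : ((Ω.filter fun a => ¬N a ≤ 2 * V).card : ℝ) * 2 ≤ Ω.card :=
    (mul_le_mul_of_nonneg_left (le_self_pow₀ one_le_two hn) (Nat.cast_nonneg _)).trans
      (le_of_mul_le_mul_right hbad (by positivity))
  have hsplit := card_filter_add_card_filter_not (s := Ω) fun a => N a ≤ 2 * V
  have : (Ω.filter fun a => ¬N a ≤ 2 * V).card * 2 ≤ Ω.card := by exact_mod_cast htwo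
  omega

lemma card_pow_le_two_mul_card_filter_sampleMean {f : G → ℝ} (hf₀ : ∀ x, 0 ≤ f x)
    (hf₁ : ∀ x, f x ≤ 1) {E P : Finset G} (hPne : P.Nonempty)
    (hP : ∀ x, conv f (muFn E) x ≠ 0 → x ∈ P) {α θ : ℝ} (hα : 0 < α) (hθ₀ : 0 < θ) (hθ₁ : θ ≤ 1)
    {p m : ℕ} [Fact (1 ≤ ((2 * p : ℕ) : ℝ≥0∞))] (hp : p ≠ 0) (hm : 22 * p ≤ m * (θ ^ 2 * α)) :
    E.card ^ m ≤ 2 * ((Fintype.piFinset fun _ : Fin m => E).filter fun a =>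
      ‖toLp ((2 * p : ℕ) : ℝ≥0∞) (sampleMean f a - conv f (muFn E))‖ ≤
        2 * (θ * ‖toLp ((2 * p : ℕ) : ℝ≥0∞)
          fun x => indicatorFn P x * (conv f (muFn E) x + α)‖)).card := by
  have hp₂ : 2 * p ≠ 0 := by omega
  have hcard : (Fintype.piFinset fun _ : Fin m => E).card = E.card ^ m := by
    simp [Fintype.card_piFinset]
  have hV₀ : 0 < ‖toLp ((2 * p : ℕ) : ℝ≥0∞)
      fun x => indicatorFn P x * (conv f (muFn E) x + α)‖ := by
    obtain ⟨x, hx⟩ := hPne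
    refine norm_pos_iff.2 fun h => ?_
    have hx₀ : indicatorFn P x * (conv f (muFn E) x + α) = 0 := congrFun (congrArg ofLp h) x
    rw [indicatorFn_of_mem hx, one_mul, conv_muFn_apply] at hx₀
    exact (add_pos_of_nonneg_of_pos (expect_nonneg fun y _ => hf₀ (x - y)) hα).ne' hx₀
  rw [← hcard]
  refine card_le_two_mul_card_filter_le (fun a => norm_nonneg _) (mul_pos hθ₀ hV₀) hp₂ ?_
  simp_rw [norm_toLp_pow hp₂]
  rw [sum_comm, mul_pow, norm_toLp_pow hp₂, hcard, Nat.cast_pow, mul_sum, mul_sum]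
  exact sum_le_sum fun x _ =>
    sum_piFinset_abs_sampleMean_sub_conv_pow_le hf₀ hf₁ hP hα hθ₀ hθ₁ hp hm x

theorem exists_almostPeriods [DecidableEq G] {f : G → ℝ} (hf₀ : ∀ x, 0 ≤ f x)
    (hf₁ : ∀ x, f x ≤ 1) {E P S : Finset G} (hE : E.Nonempty) (hS : S.Nonempty)
    (hPne : P.Nonempty) (hP : ∀ x, conv f (muFn E) x ≠ 0 → x ∈ P) {K : ℝ}
    (hK : ((E + S).card : ℝ) ≤ K * E.card) {α θ : ℝ} (hα : 0 < α) (hθ₀ : 0 < θ) (hθ₁ : θ ≤ 1)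
    {p m : ℕ} [Fact (1 ≤ ((2 * p : ℕ) : ℝ≥0∞))] (hp : p ≠ 0) (hm : 22 * p ≤ m * (θ ^ 2 * α)) :
    ∃ X ⊆ S, (S.card : ℝ) ≤ 2 * K ^ m * X.card ∧ ∀ s ∈ X, ∀ s' ∈ X,
      ‖toLp ((2 * p : ℕ) : ℝ≥0∞) (τ (s - s') (conv f (muFn E)) - conv f (muFn E))‖ ≤
        4 * θ * ‖toLp ((2 * p : ℕ) : ℝ≥0∞)
          fun x => indicatorFn P x * (conv f (muFn E) x + α)‖ := by
  have hgood := card_pow_le_two_mul_card_filter_sampleMean hf₀ hf₁ hPne hP hα hθ₀ hθ₁ hp hm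
  set V := ‖toLp ((2 * p : ℕ) : ℝ≥0∞) fun x => indicatorFn P x * (conv f (muFn E) x + α)‖
  set h := conv f (muFn E)
  obtain ⟨b, X, hXS, hcard, hX⟩ := exists_large_subset_of_card_add_le hE hS hK
    (fun a ha => Fintype.mem_piFinset.1 (mem_filter.1 ha).1) (by exact_mod_cast hgood)
  have hnear (s) (hs : s ∈ X) :
      ‖toLp ((2 * p : ℕ) : ℝ≥0∞) (sampleMean f b - τ s h)‖ ≤ 2 * (θ * V) := by
    have hb : sampleMean f b = τ s (sampleMean f fun i => b i - s) := by
      simp [sampleMean_translate]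
    rw [hb, ← translate_sub_right, norm_toLp_translate]
    exact (mem_filter.1 (hX s hs)).2
  refine ⟨X, hXS, hcard, fun s hs s' hs' => ?_⟩
  have hsplit : τ s' (τ (s - s') h - h)
      = (sampleMean f b - τ s' h) - (sampleMean f b - τ s h) := by
    rw [translate_sub_right, translate_translate, add_sub_cancel]
    abel
  rw [← norm_toLp_translate _ s', hsplit, toLp_sub]
  refine (norm_sub_le _ _).trans ?_
  linarith [hnear s hs, hnear s' hs']

end AlmostPeriods

/-! ### The large spectrum of a dense subset of a Bohr set -/

section SignPowers

variable {G : Type*} [AddCommGroup G] [Finite G]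

lemma norm_mul_char_sub_one_le (χ ψ : AddChar G ℂ) (t : G) :
    ‖(χ * ψ) t - 1‖ ≤ ‖χ t - 1‖ + ‖ψ t - 1‖ := by
  calc ‖(χ * ψ) t - 1‖ = ‖(χ t - 1) * ψ t + (ψ t - 1)‖ := by rw [AddChar.mul_apply]; ring_nf
    _ ≤ ‖χ t - 1‖ + ‖ψ t - 1‖ :=
        (norm_add_le _ _).trans_eq (by rw [norm_mul, AddChar.norm_apply, mul_one])

lemma norm_inv_char_sub_one (χ : AddChar G ℂ) (t : G) : ‖χ⁻¹ t - 1‖ = ‖χ t - 1‖ := by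
  rw [AddChar.inv_apply, norm_char_neg_sub_one]

lemma norm_zpow_sign_sub_one {s : SignType} (hs : s ≠ 0) (χ : AddChar G ℂ) (t : G) :
    ‖(χ ^ (s : ℤ)) t - 1‖ = ‖χ t - 1‖ := by
  cases s
  · exact absurd rfl hs
  · simpa using norm_inv_char_sub_one χ t
  · simp

lemma norm_zpow_sign_sub_one_le (s : SignType) (χ : AddChar G ℂ) (t : G) :
    ‖(χ ^ (s : ℤ)) t - 1‖ ≤ ‖χ t - 1‖ := by
  rcases eq_or_ne s 0 with rfl | hs
  · simp
  · exact (norm_zpow_sign_sub_one hs χ t).le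

lemma norm_prod_zpow_sign_sub_one_le (Λ : Finset (AddChar G ℂ)) (ω : AddChar G ℂ → SignType)
    (t : G) : ‖(∏ χ ∈ Λ, χ ^ (ω χ : ℤ)) t - 1‖ ≤ ∑ χ ∈ Λ, ‖χ t - 1‖ :=
  (apply_prod_le_sum_apply Λ (fun ψ : AddChar G ℂ => ‖ψ t - 1‖) (by simp)
    fun χ ψ => norm_mul_char_sub_one_le χ ψ t).trans
      (sum_le_sum fun χ _ => norm_zpow_sign_sub_one_le (ω χ) χ t)

end SignPowers

section RieszFactors

/-- The coefficients of the trigonometric polynomial `1 + s Re(c χ)`. -/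
noncomputable def rieszCoeff (s : ℝ) (c : ℂ) : SignType → ℂ
  | .zero => 1
  | .pos => s * c / 2
  | .neg => s * conj c / 2

lemma sum_norm_rieszCoeff_le {s : ℝ} (hs₀ : 0 ≤ s) (hs₁ : s ≤ 1) {c : ℂ} (hc : ‖c‖ ≤ 1) :
    ∑ j : SignType, ‖rieszCoeff s c j‖ ≤ 2 := by
  have hsc : s * ‖c‖ ≤ 1 := mul_le_one₀ hs₁ (norm_nonneg c) hc
  rw [SignType.univ_eq, sum_insert (by decide), sum_insert (by decide), sum_singleton]
  simp [rieszCoeff, abs_of_nonneg hs₀]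
  linarith

variable {G : Type*} [AddCommGroup G] [Finite G]

lemma sum_rieszCoeff (s : ℝ) (c : ℂ) (χ : AddChar G ℂ) (x : G) :
    ∑ j : SignType, rieszCoeff s c j * (χ ^ (j : ℤ)) x = ((1 + s * (c * χ x).re : ℝ) : ℂ) := by
  have hsum : ∑ j : SignType, rieszCoeff s c j * (χ ^ (j : ℤ)) x
      = 1 + s * conj c / 2 * conj (χ x) + s * c / 2 * χ x := by
    rw [← AddChar.map_neg_eq_conj, SignType.univ_eq, sum_insert (by decide),
      sum_insert (by decide), sum_singleton]
    simp [rieszCoeff, ← add_assoc]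
  rw [hsum]
  push_cast
  rw [Complex.re_eq_add_conj, map_mul]
  ring

lemma abs_re_mul_char_le {c : ℂ} (hc : ‖c‖ ≤ 1) (χ : AddChar G ℂ) (x : G) :
    |(c * χ x).re| ≤ 1 :=
  (Complex.abs_re_le_norm _).trans (by rwa [norm_mul, AddChar.norm_apply, mul_one])

/-- The chord of `exp (· / 2)` on `[-1, 1]`, written so that it becomes a factor of a Riesz
product. -/
lemma exp_half_le {t : ℝ} (ht : |t| ≤ 1) :
    Real.exp (t / 2) ≤ Real.cosh (1 / 2) * (1 + Real.tanh (1 / 2) * t) := by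
  obtain ⟨hlow, hup⟩ := abs_le.1 ht
  have hconvex := convexOn_exp.2 (Set.mem_univ (1 / 2 : ℝ)) (Set.mem_univ (-(1 / 2) : ℝ))
    (show 0 ≤ (1 + t) / 2 by linarith) (show 0 ≤ (1 - t) / 2 by linarith) (by ring)
  have hchord : Real.cosh (1 / 2) * (1 + Real.tanh (1 / 2) * t)
      = (1 + t) / 2 * Real.exp (1 / 2) + (1 - t) / 2 * Real.exp (-(1 / 2)) := by
    rw [mul_add, ← mul_assoc, mul_one, Real.tanh_eq_sinh_div_cosh,
      mul_div_cancel₀ _ (Real.cosh_pos _).ne', Real.cosh_eq, Real.sinh_eq]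
    ring
  rw [hchord]
  simp only [smul_eq_mul] at hconvex
  exact (congrArg Real.exp (by ring)).trans_le hconvex

end RieszFactors

section RieszProducts

variable {G : Type*} [AddCommGroup G] [Fintype G]

/-- `Λ` is dissociated relative to `β`, with threshold `ε`, if all nontrivial products of elements
of `Λ` with exponents in `{-1, 0, 1}` have Fourier coefficient at most `ε`. -/
def IsDissociated (β : G → ℝ) (ε : ℝ) (Λ : Finset (AddChar G ℂ)) : Prop :=
  ∀ ω : AddChar G ℂ → SignType, (∃ χ ∈ Λ, ω χ ≠ 0) → ‖ft β (∏ χ ∈ Λ, χ ^ (ω χ : ℤ))‖ ≤ ε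

variable {β : G → ℝ} {ε : ℝ} {Λ Λ' : Finset (AddChar G ℂ)}

lemma isDissociated_empty : IsDissociated β ε ∅ := by
  rintro ω ⟨χ, hχ, -⟩
  exact absurd hχ (notMem_empty χ)

lemma IsDissociated.mono (h : IsDissociated β ε Λ) (hsub : Λ' ⊆ Λ) : IsDissociated β ε Λ' := by
  classical
  rintro ω ⟨χ, hχ, hω⟩
  have hle := h (fun χ => if χ ∈ Λ' then ω χ else 0) ⟨χ, hsub hχ, by simpa [hχ] using hω⟩
  rwa [← prod_subset hsub fun χ _ hχ => by simp [hχ],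
    prod_congr rfl fun χ hχ => by rw [if_pos hχ]] at hle

lemma IsDissociated.norm_ft_prod_le (h : IsDissociated β ε Λ) {ω : Λ → SignType} (hω : ω ≠ 0) :
    ‖ft β (∏ χ : Λ, χ.1 ^ (ω χ : ℤ))‖ ≤ ε := by
  classical
  have hext (χ : Λ) : (if h : χ.1 ∈ Λ then ω ⟨χ, h⟩ else 0) = ω χ := dif_pos χ.2
  obtain ⟨χ, hχ⟩ := Function.ne_iff.1 hω
  have hle := h (fun χ => if h : χ ∈ Λ then ω ⟨χ, h⟩ else 0) ⟨χ, χ.2, by rw [hext]; exact hχ⟩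
  rw [← prod_coe_sort] at hle
  simpa only [hext] using hle

lemma sum_mul_riesz_eq (β : G → ℝ) (Λ : Finset (AddChar G ℂ)) (s : ℝ) (c : AddChar G ℂ → ℂ) :
    ((∑ x, β x * ∏ χ ∈ Λ, (1 + s * (c χ * χ x).re) : ℝ) : ℂ)
      = ∑ ω : Λ → SignType,
        (∏ χ : Λ, rieszCoeff s (c χ) (ω χ)) * ft β (∏ χ : Λ, χ.1 ^ (ω χ : ℤ)) := by
  classical
  have hexpand (x) : ((∏ χ ∈ Λ, (1 + s * (c χ * χ x).re) : ℝ) : ℂ)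
      = ∑ ω : Λ → SignType,
        (∏ χ : Λ, rieszCoeff s (c χ) (ω χ)) * (∏ χ : Λ, χ.1 ^ (ω χ : ℤ)) x := by
    rw [Complex.ofReal_prod, ← prod_coe_sort]
    simp_rw [← sum_rieszCoeff, Fintype.prod_sum, prod_mul_distrib, AddChar.prod_apply]
  simp_rw [Complex.ofReal_sum, Complex.ofReal_mul, hexpand, ft, mul_sum]
  rw [sum_comm]
  exact sum_congr rfl fun ω _ => sum_congr rfl fun x _ => mul_left_comm _ _ _

lemma sum_mul_riesz_le (hβ : β ∈ stdSimplex ℝ G) (hΛ : IsDissociated β ε Λ) (hε₀ : 0 ≤ ε)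
    (hε : 2 ^ Λ.card * ε ≤ 1) {s : ℝ} (hs₀ : 0 ≤ s) (hs₁ : s ≤ 1) {c : AddChar G ℂ → ℂ}
    (hc : ∀ χ, ‖c χ‖ ≤ 1) : ∑ x, β x * ∏ χ ∈ Λ, (1 + s * (c χ * χ x).re) ≤ 2 := by
  classical
  have hterm (ω : Λ → SignType) :
      ‖(∏ χ : Λ, rieszCoeff s (c χ) (ω χ)) * ft β (∏ χ : Λ, χ.1 ^ (ω χ : ℤ))‖
        ≤ (∏ χ : Λ, ‖rieszCoeff s (c χ) (ω χ)‖) * ε + if ω = 0 then 1 else 0 := by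
    have hprod₀ : 0 ≤ ∏ χ : Λ, ‖rieszCoeff s (c χ) (ω χ)‖ := prod_nonneg fun _ _ => norm_nonneg _
    rw [norm_mul, norm_prod]
    split_ifs with hω
    · have hone : ∏ χ : Λ, ‖rieszCoeff s (c χ) (ω χ)‖ = 1 :=
        prod_eq_one fun χ _ => by simp [hω, rieszCoeff]
      rw [hone]
      linarith [norm_ft_le_one hβ (∏ χ : Λ, χ.1 ^ (ω χ : ℤ))]
    · rw [add_zero]
      exact mul_le_mul_of_nonneg_left (hΛ.norm_ft_prod_le hω) hprod₀
  have hcoeff : ∑ ω : Λ → SignType, ∏ χ : Λ, ‖rieszCoeff s (c χ) (ω χ)‖ ≤ 2 ^ Λ.card := by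
    rw [← Fintype.prod_sum fun (χ : Λ) j => ‖rieszCoeff s (c χ) j‖]
    calc ∏ χ : Λ, ∑ j, ‖rieszCoeff s (c χ) j‖ ≤ ∏ _χ : Λ, (2 : ℝ) :=
          prod_le_prod (fun _ _ => sum_nonneg fun _ _ => norm_nonneg _)
            fun χ _ => sum_norm_rieszCoeff_le hs₀ hs₁ (hc χ)
      _ = 2 ^ Λ.card := by simp
  calc ∑ x, β x * ∏ χ ∈ Λ, (1 + s * (c χ * χ x).re)
      ≤ ‖((∑ x, β x * ∏ χ ∈ Λ, (1 + s * (c χ * χ x).re) : ℝ) : ℂ)‖ :=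
        Complex.re_le_norm ((∑ x, β x * ∏ χ ∈ Λ, (1 + s * (c χ * χ x).re) : ℝ) : ℂ)
    _ ≤ ∑ ω : Λ → SignType,
          ((∏ χ : Λ, ‖rieszCoeff s (c χ) (ω χ)‖) * ε + if ω = 0 then 1 else 0) := by
        rw [sum_mul_riesz_eq]
        exact (norm_sum_le _ _).trans (sum_le_sum fun ω _ => hterm ω)
    _ = (∑ ω : Λ → SignType, ∏ χ : Λ, ‖rieszCoeff s (c χ) (ω χ)‖) * ε + 1 := by
        rw [sum_add_distrib, ← sum_mul, sum_ite_eq' univ (0 : Λ → SignType), if_pos (mem_univ _)]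
    _ ≤ 2 := by linarith [mul_le_mul_of_nonneg_right hcoeff hε₀]

lemma sum_mul_exp_half_sum_re_le (hβ : β ∈ stdSimplex ℝ G) (hΛ : IsDissociated β ε Λ)
    (hε₀ : 0 ≤ ε) (hε : 2 ^ Λ.card * ε ≤ 1) {c : AddChar G ℂ → ℂ} (hc : ∀ χ, ‖c χ‖ ≤ 1) :
    ∑ x, β x * Real.exp ((∑ χ ∈ Λ, (c χ * χ x).re) / 2) ≤ 2 * Real.exp (Λ.card / 8) := by
  have htanh₀ : 0 ≤ Real.tanh (1 / 2) := by
    rw [Real.tanh_eq_sinh_div_cosh]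
    exact div_nonneg (Real.sinh_nonneg_iff.2 (by norm_num)) (Real.cosh_pos _).le
  have hriesz := sum_mul_riesz_le hβ hΛ hε₀ hε htanh₀ (Real.tanh_lt_one _).le hc
  have hpoint (x) : Real.exp ((∑ χ ∈ Λ, (c χ * χ x).re) / 2) ≤ Real.cosh (1 / 2) ^ Λ.card
      * ∏ χ ∈ Λ, (1 + Real.tanh (1 / 2) * (c χ * χ x).re) := by
    rw [← prod_const, ← prod_mul_distrib, sum_div, Real.exp_sum]
    exact prod_le_prod (fun _ _ => (Real.exp_pos _).le)
      fun χ _ => exp_half_le (abs_re_mul_char_le (hc χ) χ x)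
  have hcosh : Real.cosh (1 / 2) ^ Λ.card ≤ Real.exp (Λ.card / 8) := by
    calc Real.cosh (1 / 2) ^ Λ.card ≤ Real.exp (1 / 8) ^ Λ.card :=
          pow_le_pow_left₀ (Real.cosh_pos _).le
            ((Real.cosh_le_exp_half_sq _).trans (by norm_num)) _
      _ = Real.exp (Λ.card / 8) := by rw [← Real.exp_nat_mul]; congr 1; ring
  calc ∑ x, β x * Real.exp ((∑ χ ∈ Λ, (c χ * χ x).re) / 2)
      ≤ ∑ x, β x * (Real.cosh (1 / 2) ^ Λ.card
          * ∏ χ ∈ Λ, (1 + Real.tanh (1 / 2) * (c χ * χ x).re)) :=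
        sum_le_sum fun x _ => mul_le_mul_of_nonneg_left (hpoint x) (hβ.1 x)
    _ = Real.cosh (1 / 2) ^ Λ.card
          * ∑ x, β x * ∏ χ ∈ Λ, (1 + Real.tanh (1 / 2) * (c χ * χ x).re) := by
        rw [mul_sum]
        exact sum_congr rfl fun x _ => mul_left_comm _ _ _
    _ ≤ Real.cosh (1 / 2) ^ Λ.card * 2 :=
        mul_le_mul_of_nonneg_left hriesz (pow_nonneg (Real.cosh_pos _).le _)
    _ ≤ 2 * Real.exp (Λ.card / 8) := by linarith

end RieszProducts

section Chang

variable {G : Type*} [AddCommGroup G] [Fintype G] {μ β : G → ℝ} {K ε : ℝ}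
  {Λ : Finset (AddChar G ℂ)}

lemma sum_mul_re_mul_char (f : G → ℝ) (c : ℂ) (χ : AddChar G ℂ) :
    ∑ x, f x * (c * χ x).re = (c * ft f χ).re := by
  simp only [ft, mul_sum, Complex.re_sum, mul_left_comm c, Complex.re_ofReal_mul]

theorem card_le_of_isDissociated (hβ : β ∈ stdSimplex ℝ G) (hμ : μ ∈ stdSimplex ℝ G)
    (hμβ : ∀ x, μ x ≤ K * β x) (hΛ : IsDissociated β ε Λ) (hε₀ : 0 ≤ ε)
    (hε : 2 ^ Λ.card * ε ≤ 1) (hspec : ∀ χ ∈ Λ, 1 / 2 ≤ ‖ft μ χ‖) :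
    (Λ.card : ℝ) ≤ 8 * Real.log (2 * K) := by
  choose c hc hphase using fun χ : AddChar G ℂ => RCLike.exists_norm_eq_mul_self (ft μ χ)
  have hK : 1 ≤ K := by
    simpa [hμ.2, ← mul_sum, hβ.2] using sum_le_sum fun x (_ : x ∈ univ) => hμβ x
  set R : G → ℝ := fun x => ∑ χ ∈ Λ, (c χ * χ x).re
  have hmean : Λ.card / 2 ≤ ∑ x, μ x * R x := by
    calc (Λ.card : ℝ) / 2 = ∑ χ ∈ Λ, (1 / 2 : ℝ) := by rw [sum_const, nsmul_eq_mul]; ring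
      _ ≤ ∑ χ ∈ Λ, ‖ft μ χ‖ := sum_le_sum hspec
      _ = ∑ x, μ x * R x := by
          simp only [R, mul_sum]
          rw [sum_comm]
          refine sum_congr rfl fun χ _ => ?_
          rw [sum_mul_re_mul_char, ← hphase]
          rfl
  have hjensen : Real.exp (∑ x, μ x * (R x / 2)) ≤ ∑ x, μ x * Real.exp (R x / 2) := by
    simpa only [smul_eq_mul] using convexOn_exp.map_sum_le (t := univ) (w := μ)
      (p := fun x => R x / 2) (fun x _ => hμ.1 x) hμ.2 fun _ _ => Set.mem_univ _
  have hexp : Real.exp (Λ.card / 8) * Real.exp (Λ.card / 8)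
      ≤ 2 * K * Real.exp (Λ.card / 8) := by
    calc Real.exp (Λ.card / 8) * Real.exp (Λ.card / 8)
        = Real.exp (Λ.card / 4) := by rw [← Real.exp_add]; ring_nf
      _ ≤ Real.exp (∑ x, μ x * (R x / 2)) := by
          simp only [← mul_div_assoc, ← sum_div]
          exact Real.exp_le_exp.2 (by linarith)
      _ ≤ ∑ x, K * (β x * Real.exp (R x / 2)) := hjensen.trans <| sum_le_sum fun x _ => by
          rw [← mul_assoc]
          exact mul_le_mul_of_nonneg_right (hμβ x) (Real.exp_pos _).le
      _ ≤ K * (2 * Real.exp (Λ.card / 8)) := by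
          rw [← mul_sum]
          gcongr
          exact sum_mul_exp_half_sum_re_le hβ hΛ hε₀ hε fun χ => (hc χ).le
      _ = 2 * K * Real.exp (Λ.card / 8) := by ring
  linarith [(Real.le_log_iff_exp_le (by linarith)).2
    (le_of_mul_le_mul_right hexp (Real.exp_pos _))]

lemma norm_char_sub_one_le_of_not_isDissociated [DecidableEq (AddChar G ℂ)] {γ : AddChar G ℂ}
    (hΛ : IsDissociated β ε Λ) (hγΛ : γ ∉ Λ) (hnot : ¬IsDissociated β ε (insert γ Λ)) {t : G}
    {η : ℝ} (hη : ∀ ψ : AddChar G ℂ, ε < ‖ft β ψ‖ → ‖ψ t - 1‖ ≤ η) :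
    ‖γ t - 1‖ ≤ η + ∑ χ ∈ Λ, ‖χ t - 1‖ := by
  rw [IsDissociated] at hnot
  push Not at hnot
  obtain ⟨ω, ⟨χ₀, hχ₀, hne⟩, hbig⟩ := hnot
  rw [prod_insert hγΛ] at hbig
  have hωγ : ω γ ≠ 0 := by
    intro hzero
    rw [hzero, SignType.coe_zero, zpow_zero, one_mul] at hbig
    refine hbig.not_ge (hΛ ω ⟨χ₀, mem_of_mem_insert_of_ne hχ₀ ?_, hne⟩)
    rintro rfl
    exact hne hzero
  have hquot := norm_mul_char_sub_one_le (γ ^ (ω γ : ℤ) * ∏ χ ∈ Λ, χ ^ (ω χ : ℤ))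
    (∏ χ ∈ Λ, χ ^ (ω χ : ℤ))⁻¹ t
  rw [mul_inv_cancel_right, norm_zpow_sign_sub_one hωγ, norm_inv_char_sub_one] at hquot
  linarith [hη _ hbig, norm_prod_zpow_sign_sub_one_le Λ ω t]

/-- `Λ` is a maximal dissociated subset of the large spectrum of `μ`. -/
theorem exists_spectrum_control (hβ : β ∈ stdSimplex ℝ G) (hμ : μ ∈ stdSimplex ℝ G)
    (hμβ : ∀ x, μ x ≤ K * β x) {N : ℕ} (hN : 8 * Real.log (2 * K) < N) :
    ∃ Λ : Finset (AddChar G ℂ), Λ.card ≤ N ∧ ∀ (t : G) (η : ℝ), 0 ≤ η →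
      (∀ ψ : AddChar G ℂ, (1 / 2) ^ N < ‖ft β ψ‖ → ‖ψ t - 1‖ ≤ η) →
      ∀ γ : AddChar G ℂ, 1 / 2 ≤ ‖ft μ γ‖ → ‖γ t - 1‖ ≤ η + ∑ χ ∈ Λ, ‖χ t - 1‖ := by
  classical
  set F := {Λ ∈ (univ.filter fun γ => 1 / 2 ≤ ‖ft μ γ‖).powerset | IsDissociated β ((1 / 2) ^ N) Λ}
  obtain ⟨Λ, hΛF, hmax⟩ := F.exists_maximal
    ⟨∅, mem_filter.2 ⟨empty_mem_powerset _, isDissociated_empty⟩⟩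
  obtain ⟨hspec, hΛ⟩ := mem_filter.1 hΛF
  rw [mem_powerset] at hspec
  refine ⟨Λ, ?_, fun t η hη₀ hη γ hγ => ?_⟩
  · by_contra! hlt
    obtain ⟨Λ', hsub, hcard⟩ := exists_subset_card_eq hlt.le
    have hle := card_le_of_isDissociated hβ hμ hμβ (hΛ.mono hsub) (by positivity)
      (by rw [hcard, ← mul_pow]; norm_num) fun χ hχ => (mem_filter.1 (hspec (hsub hχ))).2
    rw [hcard] at hle
    exact hN.not_ge hle
  by_cases hγΛ : γ ∈ Λ
  · linarith [single_le_sum (f := fun χ : AddChar G ℂ => ‖χ t - 1‖) (fun _ _ => norm_nonneg _) hγΛ]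
  refine norm_char_sub_one_le_of_not_isDissociated hΛ hγΛ (fun hins => hγΛ ?_) hη
  refine hmax (mem_filter.2 ⟨mem_powerset.2 ?_, hins⟩) (subset_insert γ Λ) (mem_insert_self γ Λ)
  exact insert_subset (mem_filter.2 ⟨mem_univ γ, hγ⟩) hspec

end Chang

section BohrSpectrum

variable {G : Type*} [AddCommGroup G] [Fintype G]

lemma norm_char_sub_one_mul_norm_ft_le (f : G → ℝ) (ψ : AddChar G ℂ) (t : G) :
    ‖ψ t - 1‖ * ‖ft f ψ‖ ≤ ∑ x, |f (x - t) - f x| := by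
  have hft : (ψ t - 1) * ft f ψ = ft (τ t f - f) ψ := by rw [ft_sub, ft_translate]; ring
  rw [← norm_mul, hft]
  refine (norm_sum_le _ _).trans_eq (sum_congr rfl fun x _ => ?_)
  rw [norm_mul, AddChar.norm_apply, mul_one, Complex.norm_real]
  rfl

lemma abs_indicatorFn_bohrFinset_sub_le {Γ : Finset (AddChar G ℂ)} {ρ r : ℝ} (hr : 0 ≤ r) {t : G}
    (ht : t ∈ bohrFinset Γ r) (x : G) :
    |indicatorFn (bohrFinset Γ ρ) (x - t) - indicatorFn (bohrFinset Γ ρ) x|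
      ≤ indicatorFn (bohrFinset Γ (ρ + r)) x - indicatorFn (bohrFinset Γ (ρ - r)) x := by
  by_cases hin : x ∈ bohrFinset Γ (ρ - r)
  · have hx : x ∈ bohrFinset Γ ρ := bohrFinset_mono subset_rfl (by linarith) hin
    have hxt : x - t ∈ bohrFinset Γ ρ := by simpa using sub_mem_bohrFinset hin ht
    rw [indicatorFn_of_mem hin, indicatorFn_of_mem hx, indicatorFn_of_mem hxt,
      indicatorFn_of_mem (bohrFinset_mono subset_rfl (by linarith) hx)]
    simp
  rw [indicatorFn_of_notMem hin, sub_zero]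
  by_cases hout : x ∈ bohrFinset Γ (ρ + r)
  · rw [indicatorFn_of_mem hout]
    exact abs_sub_le_of_nonneg_of_le (indicatorFn_nonneg _ _) (indicatorFn_le_one _ _)
      (indicatorFn_nonneg _ _) (indicatorFn_le_one _ _)
  · have hx : x ∉ bohrFinset Γ ρ := fun h => hout (bohrFinset_mono subset_rfl (by linarith) h)
    have hxt : x - t ∉ bohrFinset Γ ρ := fun h => hout (by simpa using add_mem_bohrFinset h ht)
    rw [indicatorFn_of_notMem hout, indicatorFn_of_notMem hx, indicatorFn_of_notMem hxt]
    simp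

lemma BohrSet.IsRegular.norm_char_sub_one_le {D : BohrSet G} (hD : D.IsRegular) {δ : ℝ}
    (hδ₀ : 0 ≤ δ) (hδ : 12 * (D.rank : ℝ) * δ ≤ 1) {ψ : AddChar G ℂ}
    (hψ : 1 / 2 ≤ ‖ft (muFn D.toFinset) ψ‖) {t : G} (ht : t ∈ D.scaled δ) :
    ‖ψ t - 1‖ ≤ 48 * (D.rank : ℝ) * δ := by
  have hD₀ : (0 : ℝ) < D.toFinset.card := by exact_mod_cast card_bohrFinset_pos D.radius_nonneg
  have hboundary : ∑ x, |indicatorFn D.toFinset (x - t) - indicatorFn D.toFinset x|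
      ≤ 24 * (D.rank : ℝ) * δ * D.toFinset.card := by
    calc _ ≤ ∑ x, (indicatorFn (bohrFinset D.chars (D.radius + δ * D.radius)) x
              - indicatorFn (bohrFinset D.chars (D.radius - δ * D.radius)) x) :=
          sum_le_sum fun x _ =>
            abs_indicatorFn_bohrFinset_sub_le (mul_nonneg hδ₀ D.radius_nonneg) ht x
      _ ≤ _ := by
          rw [sum_sub_distrib, sum_indicatorFn, sum_indicatorFn]
          linarith [hD.card_le hδ₀ hδ (r := D.radius + δ * D.radius) (by linarith),
            hD.le_card hδ₀ hδ (r := D.radius - δ * D.radius) (by linarith)]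
  have hsum : ∑ x, |muFn D.toFinset (x - t) - muFn D.toFinset x| ≤ 24 * (D.rank : ℝ) * δ := by
    simp only [muFn, ← sub_div, abs_div, Nat.abs_cast, ← sum_div]
    rwa [div_le_iff₀ hD₀]
  nlinarith [norm_nonneg (ψ t - 1), norm_char_sub_one_mul_norm_ft_le (muFn D.toFinset) ψ t]

lemma convIter_muFn_bohrFinset_eq_of_eqOn {Γ : Finset (AddChar G ℂ)} {r R v : ℝ} (hr : 0 ≤ r)
    {g : G → ℝ} (j : ℕ) (hg : ∀ x ∈ bohrFinset Γ (R + j * r), g x = v) :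
    ∀ x ∈ bohrFinset Γ R, convIter (muFn (bohrFinset Γ r)) g j x = v := by
  have hμ := muFn_mem_stdSimplex ⟨0, zero_mem_bohrFinset (Γ := Γ) hr⟩
  induction j generalizing R with
  | zero => exact fun x hx => hg x (by simpa using hx)
  | succ j ih =>
    intro x hx
    have hprev := ih (R := R + r) fun y hy => hg y (by
      convert! hy using 2
      push_cast
      ring)
    rw [convIter_succ, conv_apply', ← one_mul v, ← hμ.2, sum_mul]
    refine sum_congr rfl fun y _ => ?_
    by_cases hy : muFn (bohrFinset Γ r) y = 0
    · rw [hy, zero_mul, zero_mul]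
    · rw [hprev _ (sub_mem_bohrFinset hx (mem_of_muFn_ne_zero hy))]

variable {S D : BohrSet G} {N : ℕ} {κ : ℝ} {X : Finset G}

lemma BohrSet.IsRegular.muFn_le_mul_convIter (hS : S.IsRegular) (hDS : D.chars = S.chars)
    (hκ₀ : 0 ≤ κ) (hκ : 12 * (S.rank : ℝ) * κ ≤ 1) (hrad : N * D.radius ≤ κ * S.radius)
    (hXS : X ⊆ S.toFinset) (x : G) :
    muFn X x ≤ 2 * (S.toFinset.card / X.card) *
      convIter (muFn D.toFinset) (muFn (S.scaled (1 + κ))) N x := by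
  have hr : 0 ≤ (1 + κ) * S.radius := mul_nonneg (by linarith) S.radius_nonneg
  have hwide₀ : (0 : ℝ) < (S.scaled (1 + κ)).card := by exact_mod_cast card_bohrFinset_pos hr
  by_cases hx : x ∈ X
  · have hconst : convIter (muFn D.toFinset) (muFn (S.scaled (1 + κ))) N x
        = 1 / (S.scaled (1 + κ)).card := by
      have hxS := hXS hx
      rw [BohrSet.toFinset, ← hDS] at hxS
      refine convIter_muFn_bohrFinset_eq_of_eqOn D.radius_nonneg N (fun y hy => ?_) x hxS
      rw [hDS] at hy
      rw [muFn, indicatorFn_of_mem (show y ∈ S.scaled (1 + κ) from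
        bohrFinset_mono subset_rfl (by linarith) hy)]
    have hX₀ : (0 : ℝ) < X.card := by exact_mod_cast card_pos.2 ⟨x, hx⟩
    have hcard := hS.card_scaled_le_two_mul hκ₀ hκ
    rw [hconst, muFn, indicatorFn_of_mem hx]
    calc 1 / (X.card : ℝ) = (S.scaled (1 + κ)).card / X.card * (1 / (S.scaled (1 + κ)).card) := by
          field_simp
      _ ≤ 2 * S.toFinset.card / X.card * (1 / (S.scaled (1 + κ)).card) := by gcongr
      _ = _ := by ring
  · rw [muFn, indicatorFn_of_notMem hx, zero_div]
    refine mul_nonneg (by positivity) ((convIter_mem_stdSimplex ?_ ?_ N).1 x)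
    · exact muFn_mem_stdSimplex ⟨0, zero_mem_bohrFinset D.radius_nonneg⟩
    · exact muFn_mem_stdSimplex ⟨0, zero_mem_bohrFinset hr⟩

theorem exists_annihilator (hS : S.IsRegular) (hD : D.IsRegular) (hDS : D.chars = S.chars)
    (hκ₀ : 0 ≤ κ) (hκ : 12 * (S.rank : ℝ) * κ ≤ 1) (hrad : N * D.radius ≤ κ * S.radius) {δ : ℝ}
    (hδ₀ : 0 ≤ δ) (hδ : 12 * (S.rank : ℝ) * δ ≤ 1) (hX : X.Nonempty) (hXS : X ⊆ S.toFinset)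
    (hN : 8 * Real.log (4 * (S.toFinset.card / X.card)) < N) :
    ∃ Λ : Finset (AddChar G ℂ), Λ.card ≤ N ∧ ∀ t ∈ D.scaled δ,
      ∀ γ : AddChar G ℂ, 1 / 2 ≤ ‖ft (muFn X) γ‖ →
        ‖γ t - 1‖ ≤ 48 * (S.rank : ℝ) * δ + ∑ χ ∈ Λ, ‖χ t - 1‖ := by
  have hrank : D.rank = S.rank := by rw [BohrSet.rank, BohrSet.rank, hDS]
  have hwide : muFn (S.scaled (1 + κ)) ∈ stdSimplex ℝ G :=
    muFn_mem_stdSimplex ⟨0, zero_mem_bohrFinset (mul_nonneg (by linarith) S.radius_nonneg)⟩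
  have hβ := convIter_mem_stdSimplex
    (muFn_mem_stdSimplex ⟨0, zero_mem_bohrFinset (Γ := D.chars) D.radius_nonneg⟩) hwide N
  obtain ⟨Λ, hcard, hcontrol⟩ := exists_spectrum_control hβ (muFn_mem_stdSimplex hX)
    (hS.muFn_le_mul_convIter hDS hκ₀ hκ hrad hXS) (by convert! hN using 3; ring)
  refine ⟨Λ, hcard, fun t ht γ hγ => hcontrol t _ (by positivity) (fun ψ hψ => ?_) γ hγ⟩
  rw [← hrank] at hδ ⊢
  refine hD.norm_char_sub_one_le hδ₀ hδ ?_ ht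
  contrapose! hψ
  rw [ft_convIter, norm_mul, norm_pow]
  calc ‖ft (muFn (S.scaled (1 + κ))) ψ‖ * ‖ft (muFn (bohrFinset D.chars D.radius)) ψ‖ ^ N
      ≤ 1 * (1 / 2) ^ N := by
        gcongr
        exacts [norm_ft_le_one hwide ψ, hψ.le]
    _ = (1 / 2) ^ N := one_mul _

end BohrSpectrum

/-! ### Smoothing and self-convolutions -/

section SmoothKernel

variable {G : Type*} [AddCommGroup G] [Fintype G]

/-- The kernel `μ_E * (μ_X * μ_{-X}) * ⋯ * (μ_X * μ_{-X})` with `k` factors `μ_X * μ_{-X}`. -/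
noncomputable def smoothKernel (X E : Finset G) (k : ℕ) : G → ℝ :=
  convIter (conv (muFn X) fun x => muFn X (-x)) (muFn E) k

variable {X E : Finset G}

lemma conv_muFn_neg_mem_stdSimplex (hX : X.Nonempty) :
    (conv (muFn X) fun x => muFn X (-x)) ∈ stdSimplex ℝ G := by
  have hμ := muFn_mem_stdSimplex hX
  exact conv_mem_stdSimplex hμ
    ⟨fun x => hμ.1 (-x), (Equiv.sum_comp (Equiv.neg G) (muFn X)).trans hμ.2⟩

lemma smoothKernel_mem_stdSimplex (hX : X.Nonempty) (hE : E.Nonempty) (k : ℕ) :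
    smoothKernel X E k ∈ stdSimplex ℝ G :=
  convIter_mem_stdSimplex (conv_muFn_neg_mem_stdSimplex hX) (muFn_mem_stdSimplex hE) k

lemma norm_ft_smoothKernel (X E : Finset G) (k : ℕ) (γ : AddChar G ℂ) :
    ‖ft (smoothKernel X E k) γ‖ = ‖ft (muFn E) γ‖ * ‖ft (muFn X) γ‖ ^ (2 * k) := by
  rw [smoothKernel, ft_convIter, norm_mul, norm_pow, ft_conv, norm_mul, norm_ft_neg, ← sq, pow_mul]

lemma exists_mem_add_eq_of_smoothKernel_ne_zero {Γ : Finset (AddChar G ℂ)} {r : ℝ}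
    (hX : X ⊆ bohrFinset Γ r) (k : ℕ) {y : G} (hy : smoothKernel X E k y ≠ 0) :
    ∃ e ∈ E, ∃ z ∈ bohrFinset Γ (2 * k * r), e + z = y := by
  induction k generalizing y with
  | zero => exact ⟨y, mem_of_muFn_ne_zero hy, 0, by simp [mem_bohrFinset], add_zero y⟩
  | succ k ih =>
    rw [smoothKernel, convIter_succ] at hy
    obtain ⟨u, v, hu, hv, rfl⟩ := exists_add_eq_of_conv_ne_zero hy
    obtain ⟨a, b, ha, hb, rfl⟩ := exists_add_eq_of_conv_ne_zero hv
    obtain ⟨e, he, z, hz, rfl⟩ := ih hu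
    have hdiff := sub_mem_bohrFinset (hX (mem_of_muFn_ne_zero ha)) (hX (mem_of_muFn_ne_zero hb))
    rw [sub_neg_eq_add] at hdiff
    refine ⟨e, he, z + (a + b), ?_, (add_assoc _ _ _).symm⟩
    convert! add_mem_bohrFinset hz hdiff using 2
    push_cast
    ring

lemma norm_toLp_conv_smoothKernel_sub_le {p : ℝ≥0∞} [Fact (1 ≤ p)] {f : G → ℝ} {η : ℝ}
    (hX : X.Nonempty) (hperiod : ∀ s ∈ X, ∀ s' ∈ X,
      ‖toLp p (τ (s - s') (conv f (muFn E)) - conv f (muFn E))‖ ≤ η) (k : ℕ) :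
    ‖toLp p (conv f (smoothKernel X E k) - conv f (muFn E))‖ ≤ k * η := by
  rw [smoothKernel, conv_convIter]
  refine (norm_toLp_convIter_sub_self_le (conv_muFn_neg_mem_stdSimplex hX) _ k).trans ?_
  refine mul_le_mul_of_nonneg_left ?_ k.cast_nonneg
  refine norm_toLp_conv_sub_self_le (conv_muFn_neg_mem_stdSimplex hX) _ fun y hy => ?_
  obtain ⟨s, s', hs, hs', rfl⟩ := exists_add_eq_of_conv_ne_zero hy
  simpa using hperiod s (mem_of_muFn_ne_zero hs) (-s') (mem_of_muFn_ne_zero hs')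

lemma abs_conv_translate_sub_le {f w : G → ℝ} (hf : ∀ x, |f x| ≤ 1) {Q : Finset G} {t : G}
    (hQ : ∀ y, w y ≠ 0 → y ∈ Q) (hQt : ∀ y, w y ≠ 0 → y + t ∈ Q) (x : G) :
    |conv f w (x - t) - conv f w x| ≤ √(Q.card * ∑ y, (τ t w - w) y ^ 2) := by
  have hpairing : conv f w (x - t) - conv f w x = ∑ y ∈ Q, f (x - y) * (τ t w - w) y := by
    rw [conv_apply', conv_apply', ← Equiv.sum_comp (Equiv.subRight t), ← sum_sub_distrib,
      ← sum_subset (subset_univ Q)]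
    · refine sum_congr rfl fun y _ => ?_
      simp only [Equiv.subRight_apply, Pi.sub_apply, translate_apply]
      rw [sub_sub_sub_cancel_right]
      ring
    · intro y _ hy
      have hw : w y = 0 := not_imp_comm.1 (hQ y) hy
      have hwt : w (y - t) = 0 := not_imp_comm.1 (hQt (y - t)) (by rwa [sub_add_cancel])
      simp [hw, hwt]
  rw [hpairing]
  refine Real.abs_le_sqrt ((sum_mul_sq_le_sq_mul_sq Q _ _).trans ?_)
  refine mul_le_mul ?_ (sum_le_sum_of_subset_of_nonneg (subset_univ Q) fun _ _ _ => sq_nonneg _)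
    (sum_nonneg fun _ _ => sq_nonneg _) Q.card.cast_nonneg
  simpa using sum_le_sum fun y (_ : y ∈ Q) => sq_le_one_iff_abs_le_one _ |>.2 (hf (x - y))

lemma sum_translate_smoothKernel_sub_sq_le {k : ℕ} {t : G} {η : ℝ}
    (hη : ∀ γ : AddChar G ℂ, ‖ft (muFn X) γ‖ ^ (2 * k) * ‖γ t - 1‖ ≤ η) :
    ∑ y, (τ t (smoothKernel X E k) - smoothKernel X E k) y ^ 2 ≤ η ^ 2 / E.card := by
  have hG₀ : (0 : ℝ) < Fintype.card G := by exact_mod_cast Fintype.card_pos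
  have hft (γ : AddChar G ℂ) :
      ‖ft (τ t (smoothKernel X E k) - smoothKernel X E k) γ‖ ≤ η * ‖ft (muFn E) γ‖ := by
    calc ‖ft (τ t (smoothKernel X E k) - smoothKernel X E k) γ‖
        = ‖ft (muFn X) γ‖ ^ (2 * k) * ‖γ t - 1‖ * ‖ft (muFn E) γ‖ := by
          rw [ft_sub, ft_translate, ← sub_one_mul, norm_mul, norm_ft_smoothKernel]
          ring
      _ ≤ η * ‖ft (muFn E) γ‖ := mul_le_mul_of_nonneg_right (hη γ) (norm_nonneg _)
  refine le_of_mul_le_mul_left ?_ hG₀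
  calc Fintype.card G * ∑ y, (τ t (smoothKernel X E k) - smoothKernel X E k) y ^ 2
      ≤ ∑ γ : AddChar G ℂ, (η * ‖ft (muFn E) γ‖) ^ 2 := by
        rw [← sum_norm_ft_sq]
        exact sum_le_sum fun γ _ => pow_le_pow_left₀ (norm_nonneg _) (hft γ) 2
    _ = Fintype.card G * (η ^ 2 / E.card) := by
        simp_rw [mul_pow]
        rw [← mul_sum, sum_norm_ft_sq, sum_muFn_sq]
        ring

lemma abs_conv_smoothKernel_translate_sub_le {f : G → ℝ} (hf : ∀ x, |f x| ≤ 1)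
    (hE : E.Nonempty) {Q : Finset G} {k : ℕ} {t : G}
    (hQ : ∀ y, smoothKernel X E k y ≠ 0 → y ∈ Q)
    (hQt : ∀ y, smoothKernel X E k y ≠ 0 → y + t ∈ Q) {K η : ℝ} (hK : (Q.card : ℝ) ≤ K * E.card)
    (hη : ∀ γ : AddChar G ℂ, ‖ft (muFn X) γ‖ ^ (2 * k) * ‖γ t - 1‖ ≤ η) (x : G) :
    |conv f (smoothKernel X E k) (x - t) - conv f (smoothKernel X E k) x| ≤ √K * η := by
  have hη₀ : 0 ≤ η := le_trans (by positivity) (hη 0)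
  have hE₀ : (0 : ℝ) < E.card := by exact_mod_cast hE.card_pos
  have henergy := mul_le_mul hK (sum_translate_smoothKernel_sub_sq_le (E := E) hη)
    (sum_nonneg fun _ _ => sq_nonneg _) (Q.card.cast_nonneg.trans hK)
  calc |conv f (smoothKernel X E k) (x - t) - conv f (smoothKernel X E k) x|
      ≤ √(Q.card * ∑ y, (τ t (smoothKernel X E k) - smoothKernel X E k) y ^ 2) :=
        abs_conv_translate_sub_le hf hQ hQt x
    _ ≤ √(K * η ^ 2) := Real.sqrt_le_sqrt (henergy.trans_eq (by field_simp [hE₀.ne']))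
    _ = √K * η := by rw [Real.sqrt_mul' K (sq_nonneg η), Real.sqrt_sq hη₀]

end SmoothKernel

section SelfConvolution

variable {G : Type*} [AddCommGroup G] [Fintype G]

/-- Expand `f = M 1_W - g` in `f * f` and discard the nonnegative term `g * g`. -/
lemma le_conv_self {f : G → ℝ} {M : ℝ} (hM : 0 ≤ M) (hf : ∀ x, f x ≤ M) {B W : Finset G}
    (hfW : ∀ x, f x ≠ 0 → x ∈ W) (hBW : B ⊆ W) {x : G} (hxB : ∀ y ∈ B, x - y ∈ W) :
    M ^ 2 * B.card - 2 * M * (M * W.card - ∑ y, f y) ≤ conv f f x := by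
  set g : G → ℝ := fun y => M * indicatorFn W y - f y with hg
  have hg₀ (y) : 0 ≤ g y := by
    by_cases hy : y ∈ W
    · simp [hg, indicatorFn_of_mem hy, hf y]
    · simp [hg, indicatorFn_of_notMem hy, not_imp_comm.1 (hfW y) hy]
  have hgsum : ∑ y, g y = M * W.card - ∑ y, f y := by
    rw [hg, sum_sub_distrib, ← mul_sum, sum_indicatorFn]
  have hgsub : ∑ y, g (x - y) = ∑ y, g y := Equiv.sum_comp (Equiv.subLeft x) g
  have hpoint (y) : M ^ 2 * indicatorFn B y - M * g y - M * g (x - y) ≤ f y * f (x - y) := by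
    have hfy : f y = M * indicatorFn W y - g y := by simp [hg]
    have hfxy : f (x - y) = M * indicatorFn W (x - y) - g (x - y) := by simp [hg]
    have hBWW : indicatorFn B y ≤ indicatorFn W y * indicatorFn W (x - y) := by
      by_cases hy : y ∈ B
      · rw [indicatorFn_of_mem hy, indicatorFn_of_mem (hBW hy), indicatorFn_of_mem (hxB y hy),
          one_mul]
      · rw [indicatorFn_of_notMem hy]
        exact mul_nonneg (indicatorFn_nonneg _ _) (indicatorFn_nonneg _ _)
    rw [hfy, hfxy]
    linarith [mul_le_of_le_one_left (mul_nonneg hM (hg₀ (x - y))) (indicatorFn_le_one W y),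
      mul_le_of_le_one_left (mul_nonneg hM (hg₀ y)) (indicatorFn_le_one W (x - y)),
      mul_le_mul_of_nonneg_left hBWW (sq_nonneg M), mul_nonneg (hg₀ y) (hg₀ (x - y))]
  calc M ^ 2 * B.card - 2 * M * (M * W.card - ∑ y, f y)
      = ∑ y, (M ^ 2 * indicatorFn B y - M * g y - M * g (x - y)) := by
        rw [sum_sub_distrib, sum_sub_distrib, ← mul_sum, ← mul_sum, ← mul_sum, hgsub,
          sum_indicatorFn, hgsum]
        ring
    _ ≤ conv f f x := sum_le_sum fun y _ => hpoint y

lemma sum_conv_conv_conv_neg (A : Finset G) (w μ : G → ℝ) :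
    ∑ x ∈ A, conv (conv (conv (indicatorFn A) w) μ) μ (-x)
      = ∑ z, w z * conv (conv (indicatorFn A) μ) (conv (indicatorFn A) μ) (-z) := by
  set f := conv (indicatorFn A) μ with hf
  have hcomm : conv (conv (conv (indicatorFn A) w) μ) μ = conv w (conv f μ) := by
    rw [conv_right_comm (indicatorFn A) w μ, conv_right_comm _ w μ, conv_comm]
  have hpair (z) : ∑ x ∈ A, conv f μ (-x - z) = conv f f (-z) := by
    simp only [conv]
    rw [sum_comm]
    refine sum_congr rfl fun y _ => ?_
    rw [← mul_sum]
    congr 1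
    rw [hf, conv, sum_indicatorFn_mul A fun u => μ (-z - y - u)]
    exact sum_congr rfl fun u _ => by congr 1; abel
  rw [hcomm]
  simp only [← hpair, mul_sum]
  rw [sum_comm]
  rfl

variable {B : BohrSet G} {A T : Finset G} {α κ : ℝ}

/-- A function bounded by `M = 3α/2` with mean `α` on `B` has self-convolution at least about
`(M ^ 2 - 2 M (M - α)) |B| = 3/4 α ^ 2 |B|` near `0`. -/
lemma BohrSet.IsRegular.le_conv_conv_muFn_self (hB : B.IsRegular) (hA : A ⊆ B.toFinset)
    (hα₀ : 0 < α) (hα : α * B.toFinset.card ≤ A.card) (hκ₀ : 0 ≤ κ)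
    (hκ : 12 * (B.rank : ℝ) * κ ≤ 1 / 40) (hT₀ : T.Nonempty) (hTB : T ⊆ B.scaled κ)
    (hT : ∀ x, conv (indicatorFn A) (muFn T) x ≤ 3 / 2 * α) {z : G} (hz : z ∈ B.scaled κ) :
    3 / 5 * α * A.card
      ≤ conv (conv (indicatorFn A) (muFn T)) (conv (indicatorFn A) (muFn T)) (-z) := by
  have hradius : B.radius + κ * B.radius = (1 + κ) * B.radius := by ring
  have hwide : ((B.scaled (1 + κ)).card : ℝ) ≤ (1 + 1 / 40) * B.toFinset.card := by
    refine (hB.card_le hκ₀ (by linarith) (r := (1 + κ) * B.radius) le_rfl).trans ?_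
    gcongr
  have hsub : B.toFinset ⊆ B.scaled (1 + κ) :=
    bohrFinset_mono subset_rfl (by linarith [mul_nonneg hκ₀ B.radius_nonneg])
  have hself := le_conv_self (x := -z) (by positivity) hT
    (fun x hx => by
      obtain ⟨y, y', hy, hy', rfl⟩ := exists_add_eq_of_conv_ne_zero hx
      rw [BohrSet.scaled, ← hradius]
      exact add_mem_bohrFinset (hA (mem_of_indicatorFn_ne_zero hy)) (hTB (mem_of_muFn_ne_zero hy')))
    hsub fun y hy => by
      rw [BohrSet.scaled, ← hradius, add_comm B.radius]
      exact sub_mem_bohrFinset (neg_mem_bohrFinset hz) hy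
  rw [sum_conv, (muFn_mem_stdSimplex hT₀).2, mul_one, sum_indicatorFn] at hself
  refine le_trans ?_ hself
  nlinarith [mul_le_mul_of_nonneg_left hwide (sq_nonneg α), mul_le_mul_of_nonneg_left hα hα₀.le]

lemma BohrSet.IsRegular.le_sum_conv_neg (hB : B.IsRegular) (hA : A ⊆ B.toFinset)
    (hα₀ : 0 < α) (hα : α * B.toFinset.card ≤ A.card) (hκ₀ : 0 ≤ κ)
    (hκ : 12 * (B.rank : ℝ) * κ ≤ 1 / 40) (hT₀ : T.Nonempty) (hTB : T ⊆ B.scaled κ)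
    (hT : ∀ x, conv (indicatorFn A) (muFn T) x ≤ 3 / 2 * α) {w : G → ℝ}
    (hw : w ∈ stdSimplex ℝ G) (hwB : ∀ y, w y ≠ 0 → y ∈ B.scaled κ) {η : ℝ}
    (hwT : ∀ x, |conv (conv (indicatorFn A) w) (muFn T) x - conv (indicatorFn A) w x| ≤ η) :
    (3 / 5 * α - 2 * η) * A.card ≤ ∑ x ∈ A, conv (indicatorFn A) w (-x) := by
  have hmain : 3 / 5 * α * A.card
      ≤ ∑ x ∈ A, conv (conv (conv (indicatorFn A) w) (muFn T)) (muFn T) (-x) := by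
    rw [sum_conv_conv_conv_neg, ← one_mul (3 / 5 * α * A.card), ← hw.2, sum_mul]
    refine sum_le_sum fun z _ => ?_
    by_cases hz : w z = 0
    · rw [hz, zero_mul, zero_mul]
    · exact mul_le_mul_of_nonneg_left
        (hB.le_conv_conv_muFn_self hA hα₀ hα hκ₀ hκ hT₀ hTB hT (hwB z hz)) (hw.1 z)
  have hsmooth (x) : conv (conv (conv (indicatorFn A) w) (muFn T)) (muFn T) x
      ≤ conv (indicatorFn A) w x + 2 * η := by
    have hdiff := conv_le_of_le (muFn_mem_stdSimplex hT₀)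
      (fun y => show (_ - _ : G → ℝ) y ≤ η from (abs_le.1 (hwT y)).2) x
    rw [sub_conv, Pi.sub_apply] at hdiff
    linarith [(abs_le.1 (hwT x)).2]
  have hsum := sum_le_sum fun x (_ : x ∈ A) => hsmooth (-x)
  rw [sum_add_distrib, sum_const, nsmul_eq_mul] at hsum
  linarith

end SelfConvolution

section Approximation

variable {G : Type*} [Fintype G] {A W : Finset G} {n : ℕ}

lemma norm_toLp_const_mul_indicatorFn [Fact (1 ≤ (n : ℝ≥0∞))] (hn : n ≠ 0) {c : ℝ} (hc : 0 ≤ c)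
    (W : Finset G) :
    ‖toLp (n : ℝ≥0∞) fun x => c * indicatorFn W x‖ = c * (W.card : ℝ) ^ (n : ℝ)⁻¹ := by
  rw [← pow_left_inj₀ (norm_nonneg _) (by positivity) hn, norm_toLp_pow hn, mul_pow,
    Real.rpow_inv_natCast_pow W.card.cast_nonneg hn, ← sum_indicatorFn, mul_sum]
  refine sum_congr rfl fun x _ => ?_
  by_cases hx : x ∈ W
  · rw [indicatorFn_of_mem hx, mul_one, mul_one, abs_of_nonneg hc]
  · rw [indicatorFn_of_notMem hx, mul_zero, mul_zero, abs_zero, zero_pow hn]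

lemma norm_toLp_indicatorFn_mul_add_le [Fact (1 ≤ (n : ℝ≥0∞))] (hn : n ≠ 0) {g h : G → ℝ}
    {a b : ℝ} (ha : 0 ≤ a) (hb : 0 ≤ b) (hg : ∀ x, g x ≤ b) (hh : ∀ x, 0 ≤ h x) :
    ‖toLp (n : ℝ≥0∞) fun x => indicatorFn W x * (h x + a)‖
      ≤ ‖toLp (n : ℝ≥0∞) (g - h)‖ + (b + a) * (W.card : ℝ) ^ (n : ℝ)⁻¹ := by
  calc ‖toLp (n : ℝ≥0∞) fun x => indicatorFn W x * (h x + a)‖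
      ≤ ‖toLp (n : ℝ≥0∞) (|g - h| + fun x => (b + a) * indicatorFn W x)‖ := by
        refine norm_toLp_le_of_abs_le hn fun x => ?_
        have hW := indicatorFn_nonneg W x
        simp only [Pi.add_apply, Pi.abs_apply, Pi.sub_apply]
        rw [abs_of_nonneg (mul_nonneg hW (by linarith [hh x])), abs_of_nonneg (by positivity)]
        by_cases hx : x ∈ W
        · rw [indicatorFn_of_mem hx]
          linarith [neg_abs_le (g x - h x), hg x]
        · simp [indicatorFn_of_notMem hx]
    _ ≤ ‖toLp (n : ℝ≥0∞) |g - h|‖ + ‖toLp (n : ℝ≥0∞) fun x => (b + a) * indicatorFn W x‖ := by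
        rw [toLp_add]
        exact norm_add_le _ _
    _ ≤ ‖toLp (n : ℝ≥0∞) (g - h)‖ + (b + a) * (W.card : ℝ) ^ (n : ℝ)⁻¹ := by
        rw [norm_toLp_const_mul_indicatorFn hn (by positivity)]
        gcongr
        exact norm_toLp_le_of_abs_le hn fun x => (abs_abs _).le

lemma sum_abs_neg_le_of_norm_toLp_le [AddCommGroup G] [Fact (1 ≤ (n : ℝ≥0∞))] (hn : n ≠ 0)
    {u : G → ℝ} {b : ℝ} (hb : 0 ≤ b)
    (hu : ‖toLp (n : ℝ≥0∞) u‖ ≤ b * (A.card : ℝ) ^ (n : ℝ)⁻¹) :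
    ∑ x ∈ A, |u (-x)| ≤ b * A.card := by
  rcases A.eq_empty_or_nonempty with rfl | hA
  · simp
  have hA₀ : (0 : ℝ) < A.card := by exact_mod_cast hA.card_pos
  rw [norm_toLp_le_iff hn (by positivity), mul_pow, Real.rpow_inv_natCast_pow hA₀.le hn] at hu
  have hneg : ∑ x ∈ A, |u (-x)| ^ n ≤ ∑ x, |u x| ^ n := by
    rw [← Equiv.sum_comp (Equiv.neg G) fun x => |u x| ^ n]
    exact sum_le_sum_of_subset_of_nonneg (subset_univ A) fun _ _ _ => pow_nonneg (abs_nonneg _) _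
  obtain ⟨j, rfl⟩ := Nat.exists_eq_succ_of_ne_zero hn
  have hpower := pow_sum_div_card_le_sum_pow (s := A) (f := fun x => |u (-x)|) (n := j)
    (fun x _ => abs_nonneg _)
  rw [div_le_iff₀ (by positivity)] at hpower
  refine le_of_pow_le_pow_left₀ hn (by positivity) (hpower.trans ?_)
  calc (∑ x ∈ A, |u (-x)| ^ (j + 1)) * (A.card : ℝ) ^ j
      ≤ b ^ (j + 1) * A.card * (A.card : ℝ) ^ j := by
        gcongr
        exact hneg.trans hu
    _ = (b * A.card) ^ (j + 1) := by rw [mul_pow, pow_succ (A.card : ℝ)]; ring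

/-- The relative error `‖1_W (h + α)‖` is absorbed into the left-hand side, because `g ≤ 2α`. -/
lemma sum_abs_neg_le_of_norm_toLp_sub_le [AddCommGroup G] [Fact (1 ≤ (n : ℝ≥0∞))] (hn : n ≠ 0)
    {g h : G → ℝ} {α : ℝ} (hα₀ : 0 ≤ α) (hg : ∀ x, g x ≤ 2 * α) (hh : ∀ x, 0 ≤ h x)
    (hWA : (W.card : ℝ) ≤ 2 ^ n * A.card)
    (hgh : ‖toLp (n : ℝ≥0∞) (g - h)‖
      ≤ (‖toLp (n : ℝ≥0∞) fun x => indicatorFn W x * (h x + α)‖) / 25) :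
    ∑ x ∈ A, |(g - h) (-x)| ≤ α / 4 * A.card := by
  have hroot : (W.card : ℝ) ^ (n : ℝ)⁻¹ ≤ 2 * (A.card : ℝ) ^ (n : ℝ)⁻¹ := by
    calc (W.card : ℝ) ^ (n : ℝ)⁻¹ ≤ (2 ^ n * A.card : ℝ) ^ (n : ℝ)⁻¹ := by gcongr
      _ = 2 * (A.card : ℝ) ^ (n : ℝ)⁻¹ := by
          rw [Real.mul_rpow (by positivity) A.card.cast_nonneg,
            Real.pow_rpow_inv_natCast zero_le_two hn]
  refine sum_abs_neg_le_of_norm_toLp_le hn (by positivity) ?_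
  nlinarith [norm_toLp_indicatorFn_mul_add_le (W := W) hn hα₀ (by positivity : 0 ≤ 2 * α) hg hh]

end Approximation

section NoIncrement

variable {G : Type*} [AddCommGroup G] [Fintype G]

/-- Almost periodicity transfers the lower bound from the smoothed `1_A * smoothKernel X E k`, which
is nearly `T`-invariant, to `1_A * μ_E`. -/
theorem BohrSet.IsRegular.le_sum_conv_muFn_neg {B : BohrSet G} (hB : B.IsRegular)
    {A E X T : Finset G} (hA : A ⊆ B.toFinset) (hE : E.Nonempty) (hX : X.Nonempty)
    (hT₀ : T.Nonempty) {α κ θ : ℝ} (hα₀ : 0 < α) (hα : α * B.toFinset.card ≤ A.card)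
    (hκ₀ : 0 ≤ κ) (hκ : 12 * (B.rank : ℝ) * κ ≤ 1 / 40) {n k : ℕ} [Fact (1 ≤ (n : ℝ≥0∞))]
    (hn₀ : n ≠ 0) (hn : 2 / α ≤ 2 ^ n) (hθ : k * θ ≤ 1 / 100) (hTB : T ⊆ B.scaled κ)
    (hker : ∀ y, smoothKernel X E k y ≠ 0 → y ∈ B.scaled κ)
    (hperiod : ∀ s ∈ X, ∀ s' ∈ X,
      ‖toLp (n : ℝ≥0∞) (τ (s - s') (conv (indicatorFn A) (muFn E))
        - conv (indicatorFn A) (muFn E))‖ ≤ 4 * θ * ‖toLp (n : ℝ≥0∞) fun x =>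
          indicatorFn (B.scaled (1 + κ)) x * (conv (indicatorFn A) (muFn E) x + α)‖)
    (hsmooth : ∀ x, ∀ t ∈ T, |conv (indicatorFn A) (smoothKernel X E k) (x - t)
      - conv (indicatorFn A) (smoothKernel X E k) x| ≤ α / 100)
    (hT : ∀ x, conv (indicatorFn A) (muFn T) x ≤ 3 / 2 * α) :
    α / 4 * A.card ≤ ∑ x ∈ A, conv (indicatorFn A) (muFn E) (-x) := by
  have hker₁ := smoothKernel_mem_stdSimplex hX hE k
  set g := conv (indicatorFn A) (smoothKernel X E k)
  set h := conv (indicatorFn A) (muFn E)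
  have hgT (x) : |conv g (muFn T) x - g x| ≤ α / 100 :=
    abs_conv_sub_self_le (muFn_mem_stdSimplex hT₀) x
      fun y hy => hsmooth x y (mem_of_muFn_ne_zero hy)
  have hg (x) : g x ≤ 2 * α := by
    have hgle : conv g (muFn T) x ≤ 3 / 2 * α := by
      rw [conv_right_comm]
      exact conv_le_of_le hker₁ hT x
    linarith [(abs_le.1 (hgT x)).1]
  have hh (x) : 0 ≤ h x :=
    sum_nonneg fun y _ => mul_nonneg (indicatorFn_nonneg A y) ((muFn_mem_stdSimplex hE).1 _)
  have hWA : ((B.scaled (1 + κ)).card : ℝ) ≤ 2 ^ n * A.card := by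
    calc ((B.scaled (1 + κ)).card : ℝ) ≤ 2 * B.toFinset.card :=
          hB.card_scaled_le_two_mul hκ₀ (by linarith)
      _ = 2 / α * (α * B.toFinset.card) := by field_simp
      _ ≤ 2 ^ n * A.card := by gcongr
  have happrox := sum_abs_neg_le_of_norm_toLp_sub_le hn₀ hα₀.le hg hh hWA <|
    (norm_toLp_conv_smoothKernel_sub_le hX hperiod k).trans
      (by nlinarith [norm_nonneg (toLp (n : ℝ≥0∞) fun x =>
        indicatorFn (B.scaled (1 + κ)) x * (h x + α))])
  have hmain := hB.le_sum_conv_neg hA hα₀ hα hκ₀ hκ hT₀ hTB hT hker₁ hker hgT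
  have hdiff : ∑ x ∈ A, g (-x) - ∑ x ∈ A, h (-x) ≤ ∑ x ∈ A, |(g - h) (-x)| := by
    rw [← sum_sub_distrib]
    exact sum_le_sum fun x _ => le_abs_self _
  nlinarith [mul_nonneg hα₀.le (Nat.cast_nonneg (α := ℝ) A.card)]

end NoIncrement

/-! ### Counting progressions and the choice of parameters -/

section Counting

variable {G : Type*} [AddCommGroup G]

lemma card_twoDilate (hG : Odd (Nat.card G)) (A : Finset G) : (twoDilate A).card = A.card := by
  classical
  exact card_image_of_injective _ (nsmulCoprime (Nat.coprime_two_right.2 hG)).injective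

variable [Fintype G]

lemma card_twoDilate_mul_sum_conv_le_threeAPCount [DecidableEq G] (A A' : Finset G) :
    ((twoDilate A').card : ℝ) * ∑ x ∈ A, conv (indicatorFn A) (muFn (-twoDilate A')) (-x)
      ≤ threeAPCount A A' A := by
  have hcount : (twoDilate A').card * ∑ x ∈ A, conv (indicatorFn A) (muFn (-twoDilate A')) (-x)
      = (#{q ∈ A ×ˢ twoDilate A' | q.2 - q.1 ∈ A} : ℝ) := by
    rw [card_filter, sum_product, mul_sum]
    push_cast
    refine sum_congr rfl fun x _ => ?_
    rw [conv_muFn_apply, ← card_neg, card_mul_expect, sum_neg_index]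
    refine sum_congr rfl fun y _ => ?_
    rw [sub_neg_eq_add, neg_add_eq_sub]
    by_cases h : y - x ∈ A
    · rw [indicatorFn_of_mem h, if_pos h]
    · rw [indicatorFn_of_notMem h, if_neg h]
  rw [hcount, threeAPCount, Nat.cast_le]
  refine card_le_card_of_surjOn (fun q => (q.1, 2 • q.2.1)) ?_
  rintro ⟨x, w⟩ hxw
  obtain ⟨hmem, hz⟩ := mem_filter.1 hxw
  obtain ⟨hx, hw⟩ := mem_product.1 hmem
  obtain ⟨y, hy, rfl⟩ : ∃ y ∈ A', 2 • y = w := by simpa [twoDilate] using hw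
  exact ⟨(x, y, 2 • y - x), by simp_all, rfl⟩

lemma le_supNorm {ι : Type*} [Fintype ι] (f : ι → ℝ) (x : ι) : |f x| ≤ supNorm f :=
  le_ciSup (f := fun y => |f y|) (Set.finite_range _).bddAbove x

end Counting

section Parameters

lemma exp_natCast_le_four_pow (n : ℕ) : Real.exp n ≤ 4 ^ n := by
  rw [← Real.exp_one_pow]
  exact pow_le_pow_left₀ (Real.exp_pos _).le (by linarith [Real.exp_one_lt_d9]) n

variable {α : ℝ}

lemma log_two_le_log_two_div (hα₀ : 0 < α) (hα₁ : α ≤ 1) : Real.log 2 ≤ Real.log (2 / α) :=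
  Real.log_le_log two_pos (le_div_self zero_le_two hα₀ hα₁)

lemma two_div_pow_le_four_pow_ceil (hα₀ : 0 < α) (j : ℕ) :
    (2 / α) ^ j ≤ 4 ^ ⌈j * Real.log (2 / α)⌉₊ := by
  rw [← Real.exp_log (by positivity : 0 < 2 / α), ← Real.exp_nat_mul, Real.log_exp]
  exact (Real.exp_le_exp.2 (Nat.le_ceil _)).trans (exp_natCast_le_four_pow _)

lemma two_mul_quarter_pow_le (hα₀ : 0 < α) :
    2 * (1 / 4 : ℝ) ^ (⌈2 * Real.log (2 / α)⌉₊ + 4) ≤ α ^ 2 / 200 := by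
  have hpow := two_div_pow_le_four_pow_ceil hα₀ 2
  rw [Nat.cast_two] at hpow
  calc 2 * (1 / 4 : ℝ) ^ (⌈2 * Real.log (2 / α)⌉₊ + 4)
      = 1 / 128 / 4 ^ ⌈2 * Real.log (2 / α)⌉₊ := by
        rw [pow_add, one_div_pow]; ring
    _ ≤ 1 / 128 / (2 / α) ^ 2 := by gcongr
    _ = α ^ 2 / 512 := by field_simp; norm_num
    _ ≤ α ^ 2 / 200 := by gcongr; norm_num

lemma ceil_sampleSize_le (hα₀ : 0 < α) (hα₁ : α ≤ 1) {l p k : ℝ} (hl : 0.69 ≤ l) (hp₀ : 0 ≤ p)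
    (hp : p ≤ 2.5 * l) (hk₀ : 0 < k) (hk : k ≤ 10 * l) :
    (⌈22 * p / ((1 / (100 * k)) ^ 2 * α)⌉₊ : ℝ) ≤ 6 * 10 ^ 7 * l ^ 3 / α := by
  have hcube : 1 ≤ 4 * l ^ 3 / α := by
    have : (0.69 : ℝ) ^ 3 ≤ l ^ 3 := by gcongr
    rw [one_le_div hα₀]
    linarith
  calc (⌈22 * p / ((1 / (100 * k)) ^ 2 * α)⌉₊ : ℝ) ≤ 22 * p / ((1 / (100 * k)) ^ 2 * α) + 1 :=
        (Nat.ceil_lt_add_one (by positivity)).le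
    _ = 220000 * (p * k ^ 2) / α + 1 := by field_simp; ring
    _ ≤ 220000 * (2.5 * l * (10 * l) ^ 2) / α + 4 * l ^ 3 / α := by gcongr
    _ = (220000 * 2.5 * 100 + 4) * l ^ 3 / α := by ring
    _ ≤ 6 * 10 ^ 7 * l ^ 3 / α := by gcongr; norm_num

lemma log_eight_mul_pow_le (hα₀ : 0 < α) (hα₁ : α ≤ 1) {m : ℕ}
    (hm : (m : ℝ) ≤ 6 * 10 ^ 7 * Real.log (2 / α) ^ 3 / α) :
    8 * Real.log (8 * (2 / α) ^ m) + 1 ≤ 5 * 10 ^ 8 * α⁻¹ * Real.log (2 / α) ^ 4 := by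
  have hlog2 := log_two_le_log_two_div hα₀ hα₁
  set l := Real.log (2 / α)
  have hl : (0.69 : ℝ) ≤ l := by linarith [Real.log_two_gt_d9]
  have hquartic : (0.2 : ℝ) ≤ α⁻¹ * l ^ 4 := by
    calc (0.2 : ℝ) ≤ 1 * 0.69 ^ 4 := by norm_num
      _ ≤ α⁻¹ * l ^ 4 := by gcongr; exact (one_le_inv₀ hα₀).2 hα₁
  calc 8 * Real.log (8 * (2 / α) ^ m) + 1 = 24 * Real.log 2 + 8 * (m * l) + 1 := by
        rw [Real.log_mul (by norm_num) (by positivity), Real.log_pow,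
          show (8 : ℝ) = 2 ^ 3 by norm_num, Real.log_pow]
        push_cast
        ring
    _ ≤ 24 * Real.log 2 + 8 * (6 * 10 ^ 7 * l ^ 3 / α * l) + 1 := by gcongr
    _ = 24 * Real.log 2 + 1 + 4.8 * 10 ^ 8 * (α⁻¹ * l ^ 4) := by rw [div_eq_mul_inv]; ring
    _ ≤ 5 * 10 ^ 8 * α⁻¹ * l ^ 4 := by linarith [Real.log_two_lt_d9]

/-- The parameters of the argument: the exponent `2p` of the norm in which almost-periods are
taken, the number `k` of smoothing steps, the number `m` of samples used to find almost-periods, and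
the number `N` of characters needed to annihilate the spectrum. -/
lemma exists_parameters (hα₀ : 0 < α) (hα₁ : α ≤ 1) :
    ∃ p k m N : ℕ, p ≠ 0 ∧ k ≠ 0 ∧ N ≠ 0 ∧ 2 / α ≤ 4 ^ p ∧ 2 * (1 / 4 : ℝ) ^ k ≤ α ^ 2 / 200 ∧
      22 * p ≤ m * ((1 / (100 * k : ℝ)) ^ 2 * α) ∧ 8 * Real.log (8 * (2 / α) ^ m) < N ∧
      (k : ℝ) ≤ 10 * Real.log (2 / α) ∧ (N : ℝ) ≤ 5 * 10 ^ 8 * α⁻¹ * Real.log (2 / α) ^ 4 := by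
  have hpow := two_div_pow_le_four_pow_ceil hα₀ 1
  have hquarter := two_mul_quarter_pow_le hα₀
  have hlog8 (m : ℕ) : 0 ≤ 8 * Real.log (8 * (2 / α) ^ m) := by
    have : 1 ≤ (2 / α) ^ m := one_le_pow₀ (by rw [one_le_div hα₀]; linarith)
    exact mul_nonneg (by norm_num) (Real.log_nonneg (by linarith))
  have hl : (0.69 : ℝ) ≤ Real.log (2 / α) := by
    linarith [Real.log_two_gt_d9, log_two_le_log_two_div hα₀ hα₁]
  rw [pow_one, Nat.cast_one, one_mul] at hpow
  set p := ⌈Real.log (2 / α)⌉₊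
  set k := ⌈2 * Real.log (2 / α)⌉₊ + 4 with hk
  set m := ⌈22 * p / ((1 / (100 * k : ℝ)) ^ 2 * α)⌉₊
  have hk₀ : (0 : ℝ) < k := by positivity
  have hkl : (k : ℝ) ≤ 10 * Real.log (2 / α) := by
    rw [hk]
    push_cast
    linarith [Nat.ceil_lt_add_one (a := 2 * Real.log (2 / α)) (by positivity)]
  have hpl : (p : ℝ) ≤ 2.5 * Real.log (2 / α) := by
    linarith [Nat.ceil_lt_add_one (a := Real.log (2 / α)) (by positivity)]
  have hml := ceil_sampleSize_le hα₀ hα₁ hl p.cast_nonneg hpl hk₀ hkl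
  refine ⟨p, k, m, ⌊8 * Real.log (8 * (2 / α) ^ m)⌋₊ + 1, (Nat.ceil_pos.2 (by linarith)).ne',
    by omega, by omega, hpow, hquarter, ?_, ?_, hkl, ?_⟩
  · exact (div_le_iff₀ (by positivity)).1 (Nat.le_ceil _)
  · exact_mod_cast Nat.lt_floor_add_one _
  · push_cast
    linarith [Nat.floor_le (hlog8 m), log_eight_mul_pow_le hα₀ hα₁ hml]

lemma mul_mul_pow_six_le (hα₀ : 0 < α) (hα₁ : α ≤ 1) {k N : ℝ} (hN₀ : 0 ≤ N)
    (hk : k ≤ 10 * Real.log (2 / α)) (hN : N ≤ 5 * 10 ^ 8 * α⁻¹ * Real.log (2 / α) ^ 4) :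
    k * N * α ^ 6 ≤ 16 * 10 ^ 10 := by
  have hlog : Real.log (2 / α) ≤ 2 / α := Real.log_le_self (by positivity)
  have hlog₀ : 0 ≤ Real.log (2 / α) :=
    (Real.log_nonneg one_le_two).trans (log_two_le_log_two_div hα₀ hα₁)
  calc k * N * α ^ 6
      ≤ 10 * Real.log (2 / α) * (5 * 10 ^ 8 * α⁻¹ * Real.log (2 / α) ^ 4) * α ^ 6 := by gcongr
    _ = 5 * 10 ^ 9 * Real.log (2 / α) ^ 5 * α ^ 5 := by field_simp
    _ ≤ 5 * 10 ^ 9 * (2 / α) ^ 5 * α ^ 5 := by gcongr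
    _ = 16 * 10 ^ 10 := by field_simp; norm_num

lemma rpow_log_le_pow_eight (hα₀ : 0 < α) (hα₁ : α ≤ 1) :
    α ^ (5 * 10 ^ 8 * Real.log (2 / α)) ≤ α ^ 8 := by
  rw [← Real.rpow_natCast α 8]
  refine Real.rpow_le_rpow_of_exponent_ge hα₀ hα₁ ?_
  push_cast
  linarith [Real.log_two_gt_d9, log_two_le_log_two_div hα₀ hα₁]

lemma radius_bound_le (hα₀ : 0 < α) (hα₁ : α ≤ 1) {k N r D : ℝ} (hk₀ : 0 < k) (hN₀ : 0 < N)
    (hk : k ≤ 10 * Real.log (2 / α)) (hN : N ≤ 5 * 10 ^ 8 * α⁻¹ * Real.log (2 / α) ^ 4)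
    (hr : 0 ≤ r) (hD : 0 < D) :
    1 / (10 ^ 8 * 2 ^ 48 * (16 * 10 ^ 10)) * r * α ^ (5 * 10 ^ 8 * Real.log (2 / α)) / D
      ≤ α ^ 2 * r / (10 ^ 8 * 2 ^ 48 * k * N * D) := by
  have hkN := mul_mul_pow_six_le hα₀ hα₁ hN₀.le hk hN
  have hpow := rpow_log_le_pow_eight hα₀ hα₁
  calc 1 / (10 ^ 8 * 2 ^ 48 * (16 * 10 ^ 10)) * r * α ^ (5 * 10 ^ 8 * Real.log (2 / α)) / D
      ≤ 1 / (10 ^ 8 * 2 ^ 48 * (k * N * α ^ 6)) * r * α ^ 8 / D := by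
        gcongr
    _ = α ^ 2 * r / (10 ^ 8 * 2 ^ 48 * k * N * D) := by field_simp

end Parameters

/-! ### Density increment -/

section Spectrum

variable {G : Type*} [AddCommGroup G] [Fintype G]

lemma norm_ft_pow_mul_norm_char_sub_one_le {μ : G → ℝ} (hμ : μ ∈ stdSimplex ℝ G)
    {γ : AddChar G ℂ} {t : G} {η : ℝ} (hlarge : 1 / 2 ≤ ‖ft μ γ‖ → ‖γ t - 1‖ ≤ η) {k : ℕ}
    (hk : 2 * (1 / 4 : ℝ) ^ k ≤ η) : ‖ft μ γ‖ ^ (2 * k) * ‖γ t - 1‖ ≤ η := by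
  rcases le_or_gt (1 / 2) ‖ft μ γ‖ with h | h
  · calc ‖ft μ γ‖ ^ (2 * k) * ‖γ t - 1‖ ≤ 1 * ‖γ t - 1‖ := by
          gcongr
          exact pow_le_one₀ (norm_nonneg _) (norm_ft_le_one hμ γ)
      _ ≤ η := by rw [one_mul]; exact hlarge h
  · have htwo : ‖γ t - 1‖ ≤ 2 := by
      refine (norm_sub_le _ _).trans ?_
      rw [AddChar.norm_apply, norm_one]
      norm_num
    calc ‖ft μ γ‖ ^ (2 * k) * ‖γ t - 1‖ ≤ (1 / 2) ^ (2 * k) * 2 := by gcongr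
      _ = 2 * (1 / 4) ^ k := by rw [pow_mul, mul_comm]; norm_num
      _ ≤ η := hk

variable {S : BohrSet G} {X : Finset G} {N : ℕ}

lemma BohrSet.IsRegular.exists_annihilator_of_radius_le_two (hS : S.IsRegular) (hS₂ : S.radius ≤ 2)
    (hX : X.Nonempty) (hXS : X ⊆ S.toFinset) (hN₀ : N ≠ 0)
    (hN : 8 * Real.log (4 * (S.toFinset.card / X.card)) < N) {δ : ℝ} (hδ₀ : 0 ≤ δ)
    (hδ : 12 * (S.rank : ℝ) * δ ≤ 1) :
    ∃ (r : ℝ) (Λ : Finset (AddChar G ℂ)),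
      S.radius / (12 * max (S.rank : ℝ) 1 * N * 2 ^ 16) ≤ r ∧ r ≤ S.radius ∧ N * r ≤ 1 ∧
      Λ.card ≤ N ∧ ∀ t ∈ bohrFinset S.chars (δ * r), ∀ γ, 1 / 2 ≤ ‖ft (muFn X) γ‖ →
        ‖γ t - 1‖ ≤ 48 * (S.rank : ℝ) * δ + ∑ χ ∈ Λ, ‖χ t - 1‖ := by
  have hS₀ := S.radius_nonneg
  set d := max (S.rank : ℝ) 1
  have hd₁ : 1 ≤ d := le_max_right _ _
  have hrank : (S.rank : ℝ) ≤ d := le_max_left _ _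
  have hN₁ : (1 : ℝ) ≤ N := by exact_mod_cast Nat.one_le_iff_ne_zero.2 hN₀
  obtain ⟨D, hD, hDS, hDlow, hDup⟩ := exists_isRegular S.chars
    (ρ := S.radius / (12 * d * N)) (by positivity)
  have hND : N * D.radius ≤ 1 / (12 * d) * S.radius := by
    calc N * D.radius ≤ N * (S.radius / (12 * d * N)) := by gcongr
      _ = 1 / (12 * d) * S.radius := by field_simp
  obtain ⟨Λ, hΛcard, hΛ⟩ := exists_annihilator hS hD hDS (κ := 1 / (12 * d)) (by positivity)
    (by rw [mul_one_div, div_le_one (by positivity)]; gcongr) hND hδ₀ hδ hX hXS hN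
  refine ⟨D.radius, Λ, by rwa [← div_div], hDup.trans (div_le_self hS₀ (by nlinarith)), ?_,
    hΛcard, fun t ht => hΛ t (by rwa [BohrSet.scaled, hDS])⟩
  calc N * D.radius ≤ 1 / (12 * d) * S.radius := hND
    _ ≤ 1 / (12 * 1) * 2 := by gcongr
    _ ≤ 1 := by norm_num

theorem BohrSet.IsRegular.exists_isSubBohr_annihilating (hS : S.IsRegular) (hS₂ : S.radius ≤ 2)
    (hX : X.Nonempty) (hXS : X ⊆ S.toFinset) (hN₀ : N ≠ 0)
    (hN : 8 * Real.log (4 * (S.toFinset.card / X.card)) < N) {η : ℝ} (hη₀ : 0 ≤ η) (hη₁ : η ≤ 1) :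
    ∃ T : BohrSet G, T.IsRegular ∧ T.IsSubBohr S ∧ T.rank ≤ S.rank + N ∧
      η * S.radius / (1152 * 2 ^ 32 * N * max (S.rank : ℝ) 1 ^ 2) ≤ T.radius ∧
      ∀ t ∈ T.toFinset, ∀ γ, 1 / 2 ≤ ‖ft (muFn X) γ‖ → ‖γ t - 1‖ ≤ η := by
  classical
  have hS₀ := S.radius_nonneg
  set d := max (S.rank : ℝ) 1
  have hd₁ : 1 ≤ d := le_max_right _ _
  set δ := η / (96 * d) with hδ
  have hdδ : d * δ = η / 96 := by rw [hδ]; field_simp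
  have hδ₀ : 0 ≤ δ := by positivity
  have hrankδ : S.rank * δ ≤ η / 96 := hdδ ▸ mul_le_mul_of_nonneg_right (le_max_left _ _) hδ₀
  have hδη : δ ≤ η / 96 := hdδ ▸ le_mul_of_one_le_left hδ₀ hd₁
  have hδ₁ : δ ≤ 1 := by linarith
  obtain ⟨r, Λ, hrlow, hrS, hNr, hΛcard, hΛ⟩ := hS.exists_annihilator_of_radius_le_two hS₂ hX hXS
    hN₀ hN hδ₀ (by linarith)
  have hr₀ : 0 ≤ r := le_trans (by positivity) hrlow
  obtain ⟨T, hT, hTchars, hTlow, hTup⟩ := exists_isRegular (S.chars ∪ Λ) (mul_nonneg hδ₀ hr₀)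
  refine ⟨T, hT, ⟨hTchars ▸ subset_union_left, ?_⟩, ?_, ?_, fun t ht γ hγ => ?_⟩
  · exact hTup.trans ((mul_le_of_le_one_left hr₀ hδ₁).trans hrS)
  · rw [BohrSet.rank, hTchars]
    exact (card_union_le _ _).trans (Nat.add_le_add_left hΛcard _)
  · calc η * S.radius / (1152 * 2 ^ 32 * N * d ^ 2)
        = δ * (S.radius / (12 * d * N * 2 ^ 16)) / 2 ^ 16 := by rw [hδ]; field_simp; ring
      _ ≤ δ * r / 2 ^ 16 := by gcongr
      _ ≤ T.radius := hTlow
  · have htS : t ∈ bohrFinset S.chars (δ * r) :=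
      bohrFinset_mono (hTchars ▸ subset_union_left) hTup ht
    have hsum : ∑ χ ∈ Λ, ‖χ t - 1‖ ≤ N * (δ * r) := by
      calc ∑ χ ∈ Λ, ‖χ t - 1‖ ≤ ∑ _χ ∈ Λ, δ * r := sum_le_sum fun χ hχ =>
            (mem_bohrFinset.1 ht χ (hTchars ▸ mem_union_right _ hχ)).trans hTup
        _ = Λ.card * (δ * r) := by rw [sum_const, nsmul_eq_mul]
        _ ≤ N * (δ * r) := by gcongr
    nlinarith [hΛ t htS γ hγ, mul_le_mul_of_nonneg_left hNr hδ₀]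

end Spectrum

section Dichotomy

variable {G : Type*} [AddCommGroup G] [Fintype G] {B B' : BohrSet G} {A E X : Finset G} {α κ : ℝ}

lemma BohrSet.IsRegular.card_scaled_le_of_dense (hB : B.IsRegular) (hκ₀ : 0 ≤ κ)
    (hκ : 12 * (B.rank : ℝ) * κ ≤ 1) (hα₀ : 0 < α) (hE : α * B.toFinset.card ≤ E.card) :
    ((B.scaled (1 + κ)).card : ℝ) ≤ 2 / α * E.card := by
  calc ((B.scaled (1 + κ)).card : ℝ) ≤ 2 * B.toFinset.card := hB.card_scaled_le_two_mul hκ₀ hκ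
    _ = 2 / α * (α * B.toFinset.card) := by field_simp
    _ ≤ 2 / α * E.card := by gcongr

lemma BohrSet.nonempty_of_mul_card_le (hα₀ : 0 < α) (hαE : α * B.toFinset.card ≤ E.card) :
    E.Nonempty := by
  have hB₀ : (0 : ℝ) < B.toFinset.card := by exact_mod_cast card_bohrFinset_pos B.radius_nonneg
  exact card_pos.1 (by exact_mod_cast (mul_pos hα₀ hB₀).trans_le hαE)

lemma exists_isRegular_narrow (B : BohrSet G) {k : ℕ} (hk : k ≠ 0) :
    ∃ (S : BohrSet G) (κ : ℝ), S.IsRegular ∧ S.chars = B.chars ∧ S.radius ≤ 2 ∧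
      min B.radius 2 / (100 * max (B.rank : ℝ) 1 * k * 2 ^ 16) ≤ S.radius ∧ 0 ≤ κ ∧ κ ≤ 1 ∧
      12 * (B.rank : ℝ) * κ ≤ 1 ∧ (2 * k + 1) * S.radius ≤ κ * B.radius := by
  set d := max (B.rank : ℝ) 1
  have hd₁ : 1 ≤ d := le_max_right _ _
  have hk₁ : (1 : ℝ) ≤ k := by exact_mod_cast Nat.one_le_iff_ne_zero.2 hk
  have hmin₀ : 0 ≤ min B.radius 2 := le_min B.radius_nonneg zero_le_two
  obtain ⟨S, hS, hSB, hlow, hup⟩ := exists_isRegular B.chars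
    (ρ := min B.radius 2 / (100 * d * k)) (by positivity)
  refine ⟨S, 1 / (12 * d), hS, hSB, ?_, by rwa [← div_div], by positivity, ?_, ?_, ?_⟩
  · exact hup.trans ((div_le_self hmin₀ (by nlinarith)).trans (min_le_right _ _))
  · rw [div_le_one (by positivity)]
    linarith
  · rw [mul_one_div, div_le_one (by positivity)]
    gcongr
    exact le_max_left _ _
  · have hB₀ := B.radius_nonneg
    calc (2 * k + 1) * S.radius ≤ (2 * k + k) * (B.radius / (100 * d * k)) := by
          gcongr
          · exact S.radius_nonneg
          · exact hup.trans (by gcongr; exact min_le_left _ _)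
      _ = 3 / 100 * (B.radius / d) := by field_simp; ring
      _ ≤ 1 / 12 * (B.radius / d) := by gcongr ?_ * _; norm_num
      _ = 1 / (12 * d) * B.radius := by field_simp

lemma BohrSet.IsRegular.exists_almostPeriods (hB' : B'.IsRegular) {S : BohrSet G}
    (hSB' : S.chars = B'.chars) {κ' : ℝ} (hκ'₀ : 0 ≤ κ') (hκ' : 12 * (B'.rank : ℝ) * κ' ≤ 1)
    (hrad : S.radius ≤ κ' * B'.radius) (hA : A ⊆ B.toFinset) (hEB : E ⊆ B.scaled κ)
    (hE : E ⊆ B'.toFinset) (hκ₀ : 0 ≤ κ) (hα₀ : 0 < α) (hαE : α * B'.toFinset.card ≤ E.card)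
    (hE₀ : E.Nonempty) {θ : ℝ} (hθ₀ : 0 < θ) (hθ₁ : θ ≤ 1) {p m : ℕ}
    [Fact (1 ≤ ((2 * p : ℕ) : ℝ≥0∞))] (hp : p ≠ 0) (hm : 22 * p ≤ m * (θ ^ 2 * α)) {y : ℝ}
    (hy : 8 * Real.log (8 * (2 / α) ^ m) < y) :
    ∃ X ⊆ S.toFinset, X.Nonempty ∧ 8 * Real.log (4 * (S.toFinset.card / X.card)) < y ∧
      ∀ s ∈ X, ∀ s' ∈ X, ‖toLp ((2 * p : ℕ) : ℝ≥0∞) (τ (s - s') (conv (indicatorFn A) (muFn E))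
        - conv (indicatorFn A) (muFn E))‖ ≤ 4 * θ * ‖toLp ((2 * p : ℕ) : ℝ≥0∞) fun x =>
          indicatorFn (B.scaled (1 + κ)) x * (conv (indicatorFn A) (muFn E) x + α)‖ := by
  classical
  have hB₀ := B.radius_nonneg
  have hES : E + S.toFinset ⊆ B'.scaled (1 + κ') := by
    rintro _ hz
    obtain ⟨e, he, s, hs, rfl⟩ := mem_add.1 hz
    refine bohrFinset_mono subset_rfl (by linarith) (add_mem_bohrFinset (hE he) (ρ' := S.radius) ?_)
    rwa [← hSB']
  have hsupp (x) (hx : conv (indicatorFn A) (muFn E) x ≠ 0) : x ∈ B.scaled (1 + κ) := by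
    obtain ⟨a, e, ha, he, rfl⟩ := exists_add_eq_of_conv_ne_zero hx
    rw [BohrSet.scaled, one_add_mul]
    exact add_mem_bohrFinset (hA (mem_of_indicatorFn_ne_zero ha)) (hEB (mem_of_muFn_ne_zero he))
  obtain ⟨X, hXS, hcard, hperiod⟩ := _root_.exists_almostPeriods
    (S := S.toFinset) (P := B.scaled (1 + κ)) (indicatorFn_nonneg A)
    (indicatorFn_le_one A) hE₀ ⟨0, zero_mem_bohrFinset S.radius_nonneg⟩
    ⟨0, zero_mem_bohrFinset (by positivity)⟩ hsupp
    ((Nat.cast_le.2 (card_le_card hES)).trans (hB'.card_scaled_le_of_dense hκ'₀ hκ' hα₀ hαE))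
    hα₀ hθ₀ hθ₁ hp hm
  have hS₀ : (0 : ℝ) < S.toFinset.card := by exact_mod_cast card_bohrFinset_pos S.radius_nonneg
  have hX₀ : (0 : ℝ) < X.card := pos_of_mul_pos_right (hS₀.trans_le hcard) (by positivity)
  refine ⟨X, hXS, card_pos.1 (by exact_mod_cast hX₀), ?_, hperiod⟩
  have hratio : 4 * (S.toFinset.card / X.card : ℝ) ≤ 8 * (2 / α) ^ m := by
    rw [mul_div_assoc', div_le_iff₀ hX₀]
    linarith
  exact lt_of_le_of_lt (by gcongr) hy

lemma BohrSet.IsRegular.abs_conv_smoothKernel_sub_le (hB : B.IsRegular) {f : G → ℝ}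
    (hf : ∀ x, |f x| ≤ 1) (hE : E ⊆ B.toFinset) (hE₀ : E.Nonempty) (hα₀ : 0 < α)
    (hαE : α * B.toFinset.card ≤ E.card) (hκ₀ : 0 ≤ κ) (hκ : 12 * (B.rank : ℝ) * κ ≤ 1) {r : ℝ}
    (hr₀ : 0 ≤ r) {k : ℕ} (hr : (2 * k + 1) * r ≤ κ * B.radius) (hX : X ⊆ bohrFinset B.chars r)
    {t : G} (ht : t ∈ bohrFinset B.chars r) {η : ℝ}
    (hη : ∀ γ, ‖ft (muFn X) γ‖ ^ (2 * k) * ‖γ t - 1‖ ≤ η) (x : G) :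
    |conv f (smoothKernel X E k) (x - t) - conv f (smoothKernel X E k) x| ≤ √(2 / α) * η := by
  have hsupp (y) (hy : smoothKernel X E k y ≠ 0) :
      y ∈ bohrFinset B.chars (B.radius + 2 * k * r) := by
    obtain ⟨e, he, z, hz, rfl⟩ := exists_mem_add_eq_of_smoothKernel_ne_zero hX k hy
    exact add_mem_bohrFinset (hE he) hz
  exact abs_conv_smoothKernel_translate_sub_le hf hE₀
    (fun y hy => bohrFinset_mono subset_rfl (by linarith) (hsupp y hy))
    (fun y hy => bohrFinset_mono subset_rfl (by linarith) (add_mem_bohrFinset (hsupp y hy) ht))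
    (hB.card_scaled_le_of_dense hκ₀ hκ hα₀ hαE) hη x

lemma mem_scaled_of_smoothKernel_ne_zero (hBB' : B'.toFinset ⊆ B.scaled (κ / 2))
    (hE : E ⊆ B'.toFinset) {r : ℝ} {k : ℕ} (hr : 2 * k * r ≤ B'.radius)
    (hX : X ⊆ bohrFinset B'.chars r) {y : G} (hy : smoothKernel X E k y ≠ 0) :
    y ∈ B.scaled κ := by
  obtain ⟨e, he, z, hz, rfl⟩ := exists_mem_add_eq_of_smoothKernel_ne_zero hX k hy
  have hez := add_mem_bohrFinset (hBB' (hE he)) (hBB' (bohrFinset_mono subset_rfl hr hz))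
  rwa [← add_mul, add_halves] at hez

lemma sqrt_two_div_mul_le (hα₀ : 0 < α) (hα₁ : α ≤ 1) : √(2 / α) * (α ^ 2 / 200) ≤ α / 100 := by
  calc √(2 / α) * (α ^ 2 / 200) ≤ 2 / α * (α ^ 2 / 200) := by
        gcongr
        refine Real.sqrt_le_iff.2 ⟨by positivity, le_self_pow₀ ?_ two_ne_zero⟩
        rw [one_le_div hα₀]
        linarith
    _ = α / 100 := by field_simp; norm_num

lemma increment_radius_le {r s t k N d : ℝ} (hr₀ : 0 ≤ r) (hk₀ : 0 < k) (hN₀ : 0 < N)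
    (hd₀ : 0 < d) (hs : r / (100 * d * k * 2 ^ 16) ≤ s)
    (ht : α ^ 2 / 200 * s / (1152 * 2 ^ 32 * N * d ^ 2) ≤ t) :
    α ^ 2 * r / (10 ^ 8 * 2 ^ 48 * k * N * d ^ 3) ≤ t := by
  calc α ^ 2 * r / (10 ^ 8 * 2 ^ 48 * k * N * d ^ 3)
      ≤ α ^ 2 * r / (200 * 1152 * 100 * 2 ^ 48 * k * N * d ^ 3) := by gcongr; norm_num
    _ = α ^ 2 / 200 * (r / (100 * d * k * 2 ^ 16)) / (1152 * 2 ^ 32 * N * d ^ 2) := by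
        field_simp
    _ ≤ α ^ 2 / 200 * s / (1152 * 2 ^ 32 * N * d ^ 2) := by gcongr
    _ ≤ t := ht

theorem le_sum_conv_or_exists_increment (hB : B.IsRegular) (hB' : B'.IsRegular) (hκ₀ : 0 ≤ κ)
    (hκ : 12 * (B.rank : ℝ) * κ ≤ 1 / 40) (hBB' : B'.toFinset ⊆ B.scaled (κ / 2)) (hα₀ : 0 < α)
    (hα₁ : α ≤ 1) (hA : A ⊆ B.toFinset) (hαA : α * B.toFinset.card ≤ A.card)
    (hE : E ⊆ B'.toFinset) (hαE : α * B'.toFinset.card ≤ E.card) {p k m N : ℕ} (hp₀ : p ≠ 0)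
    (hk₀ : k ≠ 0) (hN₀ : N ≠ 0) (hp : 2 / α ≤ 4 ^ p) (hk : 2 * (1 / 4 : ℝ) ^ k ≤ α ^ 2 / 200)
    (hm : 22 * p ≤ m * ((1 / (100 * k : ℝ)) ^ 2 * α)) (hN : 8 * Real.log (8 * (2 / α) ^ m) < N) :
    α / 4 * A.card ≤ ∑ x ∈ A, conv (indicatorFn A) (muFn E) (-x) ∨
    ∃ T : BohrSet G, T.IsRegular ∧ T.IsSubBohr B' ∧ T.rank ≤ B'.rank + N ∧
      α ^ 2 * min B'.radius 2 / (10 ^ 8 * 2 ^ 48 * k * N * max (B'.rank : ℝ) 1 ^ 3) ≤ T.radius ∧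
      ∃ x, 3 / 2 * α ≤ conv (indicatorFn A) (muFn T.toFinset) x := by
  have hk₁ : (1 : ℝ) ≤ k := by exact_mod_cast Nat.one_le_iff_ne_zero.2 hk₀
  have hN₁ : (0 : ℝ) < N := by exact_mod_cast Nat.pos_of_ne_zero hN₀
  have : Fact (1 ≤ ((2 * p : ℕ) : ℝ≥0∞)) := ⟨by exact_mod_cast (by omega : 1 ≤ 2 * p)⟩
  have hE₀ := BohrSet.nonempty_of_mul_card_le hα₀ hαE
  have hBscaled : B'.toFinset ⊆ B.scaled κ := hBB'.trans <|
    bohrFinset_mono subset_rfl (mul_le_mul_of_nonneg_right (by linarith) B.radius_nonneg)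
  obtain ⟨S, κ', hS, hSB', hS₂, hSlow, hκ'₀, hκ'₁, hκ', hkS⟩ := exists_isRegular_narrow B' hk₀
  have hS₀ := S.radius_nonneg
  have hB'₀ := B'.radius_nonneg
  have hrank : S.rank = B'.rank := by rw [BohrSet.rank, BohrSet.rank, hSB']
  obtain ⟨X, hXS, hX, hcard, hperiod⟩ := hB'.exists_almostPeriods hSB' hκ'₀ hκ' (by nlinarith) hA
    (hE.trans hBscaled) hE hκ₀ hα₀ hαE hE₀ (by positivity)
    (by rw [div_le_one (by positivity)]; linarith) hp₀ hm hN
  obtain ⟨T, hT, ⟨hTS, hTrad⟩, hTrank, hTlow, hann⟩ :=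
    hS.exists_isSubBohr_annihilating hS₂ hX hXS hN₀ hcard (η := α ^ 2 / 200) (by positivity)
      (by nlinarith)
  rw [hrank] at hTrank hTlow
  rw [hSB'] at hTS
  rw [BohrSet.toFinset, hSB'] at hXS
  have hTB' : T.toFinset ⊆ bohrFinset B'.chars S.radius := bohrFinset_mono hTS hTrad
  rw [or_iff_not_imp_right]
  intro hinc
  refine hB.le_sum_conv_muFn_neg (T := T.toFinset) hA hE₀ hX
    (card_pos.1 (card_bohrFinset_pos T.radius_nonneg)) hα₀ hαA hκ₀ hκ (by omega)
    (by rw [pow_mul]; norm_num; exact hp) (le_of_eq (by field_simp)) ?_ ?_ hperiod ?_ ?_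
  · exact hTB'.trans ((bohrFinset_mono subset_rfl (by nlinarith)).trans hBscaled)
  · exact fun y hy => mem_scaled_of_smoothKernel_ne_zero hBB' hE (by nlinarith) hXS hy
  · refine fun x t ht => (hB'.abs_conv_smoothKernel_sub_le (fun y => ?_) hE hE₀ hα₀ hαE hκ'₀ hκ'
      hS₀ hkS hXS (hTB' ht) (fun γ => norm_ft_pow_mul_norm_char_sub_one_le
        (muFn_mem_stdSimplex hX) (hann t ht γ) hk) x).trans (sqrt_two_div_mul_le hα₀ hα₁)
    rw [abs_of_nonneg (indicatorFn_nonneg A y)]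
    exact indicatorFn_le_one A y
  · by_contra! hx
    obtain ⟨x, hx⟩ := hx
    exact hinc ⟨T, hT, ⟨hTS, hTrad.trans (by nlinarith)⟩, hTrank, increment_radius_le
      (le_min hB'₀ zero_le_two) (by positivity) hN₁ (by positivity) hSlow hTlow, x, hx.le⟩

end Dichotomy

lemma relDensity_le_one {G : Type*} {A B : Finset G} (hAB : A ⊆ B) : relDensity A B ≤ 1 :=
  div_le_one_of_le₀ (by exact_mod_cast card_le_card hAB) (Nat.cast_nonneg _)

lemma BohrSet.le_relDensity_iff {G : Type*} [AddCommGroup G] [Fintype G] {B : BohrSet G}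
    {A : Finset G} {α : ℝ} : α ≤ relDensity A B.toFinset ↔ α * B.toFinset.card ≤ A.card :=
  le_div_iff₀ (by exact_mod_cast card_bohrFinset_pos B.radius_nonneg)

theorem mainTheorem4_general :
    ∃ c : ℝ, 0 < c ∧ ∃ C : ℝ, 0 < C ∧
      ∀ (G : Type*) [AddCommGroup G] [Fintype G] (B B' : BohrSet G), B.IsRegular → B'.IsRegular →
        B'.toFinset ⊆ B.scaled (c / (B.rank : ℝ)) →
      ∀ (α : ℝ), 0 < α →
      ∀ (A A' : Finset G), A ⊆ B.toFinset → twoDilate A' ⊆ B'.toFinset →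
        α ≤ relDensity A B.toFinset → α ≤ relDensity (twoDilate A') B'.toFinset →
        α / 4 * (A.card : ℝ) * ((twoDilate A').card : ℝ) ≤ (threeAPCount A A' A : ℝ) ∨
        ∃ T : BohrSet G, T.IsRegular ∧ T.IsSubBohr B' ∧
          (T.rank : ℝ) ≤ (B'.rank : ℝ) + C * α⁻¹ * Real.log (2 / α) ^ 4 ∧
          c * min B'.radius 2 * α ^ (C * Real.log (2 / α)) / max (B'.rank : ℝ) 1 ^ 3
            ≤ T.radius ∧
          3 / 2 * α ≤ supNorm (conv (indicatorFn A) (muFn T.toFinset)) := by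
  classical
  refine ⟨1 / (10 ^ 8 * 2 ^ 48 * (16 * 10 ^ 10)), by positivity, 5 * 10 ^ 8, by norm_num, ?_⟩
  intro G _ _ B B' hB hB' hBB' α hα₀ A A' hA hA' hαA hαA'
  have hα₁ : α ≤ 1 := hαA.trans (relDensity_le_one hA)
  have hE : -twoDilate A' ⊆ B'.toFinset := fun y hy =>
    neg_neg y ▸ neg_mem_bohrFinset (hA' (mem_neg'.1 hy))
  have hrank : (B.rank : ℝ) / B.rank ≤ 1 := div_self_le_one _
  obtain ⟨p, k, m, N, hp₀, hk₀, hN₀, hp, hk, hm, hN, hkup, hNup⟩ := exists_parameters hα₀ hα₁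
  rcases le_sum_conv_or_exists_increment hB hB'
      (κ := 2 * (1 / (10 ^ 8 * 2 ^ 48 * (16 * 10 ^ 10)) / B.rank)) (by positivity)
      (by ring_nf at hrank ⊢; linarith)
      (by rwa [mul_div_cancel_left₀ _ two_ne_zero]) hα₀ hα₁ hA (BohrSet.le_relDensity_iff.1 hαA) hE
      (by rw [card_neg]; exact BohrSet.le_relDensity_iff.1 hαA') hp₀ hk₀ hN₀ hp hk hm hN with
    hcount | ⟨T, hT, hTB', hTrank, hTrad, x, hx⟩
  · left
    rw [mul_comm]
    exact (mul_le_mul_of_nonneg_left hcount (Nat.cast_nonneg _)).trans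
      (card_twoDilate_mul_sum_conv_le_threeAPCount A A')
  · refine Or.inr ⟨T, hT, hTB', ?_, (radius_bound_le hα₀ hα₁ (by positivity) (by positivity) hkup
      hNup (le_min B'.radius_nonneg zero_le_two) (by positivity)).trans hTrad,
      hx.trans ((le_abs_self _).trans (le_supNorm _ x))⟩
    exact (by exact_mod_cast hTrank : (T.rank : ℝ) ≤ B'.rank + N).trans (by gcongr)

theorem mainTheorem4 :
    ∃ c : ℝ, 0 < c ∧ ∃ C : ℝ, 0 < C ∧
      ∀ (G : Type*) [AddCommGroup G] [Fintype G], Odd (Fintype.card G) →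
      ∀ (B B' : BohrSet G), B.IsRegular → B'.IsRegular → B'.IsSubBohr B.two →
        B'.toFinset ⊆ B.scaled (c / (B.rank : ℝ)) →
      ∀ (α : ℝ), 0 < α →
      ∀ (A A' : Finset G), A ⊆ B.toFinset → twoDilate A' ⊆ B'.toFinset →
        α ≤ relDensity A B.toFinset → α ≤ relDensity (twoDilate A') B'.toFinset →
        α / 4 * (A.card : ℝ) * (A'.card : ℝ) ≤ (threeAPCount A A' A : ℝ) ∨
        ∃ T : BohrSet G, T.IsRegular ∧ T.IsSubBohr B' ∧
          (T.rank : ℝ) ≤ (B'.rank : ℝ) + C * α⁻¹ * Real.log (2 / α) ^ 4 ∧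
          c * min B'.radius 2 * α ^ (C * Real.log (2 / α)) / max (B'.rank : ℝ) 1 ^ 3
            ≤ T.radius ∧
          3 / 2 * α ≤ supNorm (conv (indicatorFn A) (muFn T.toFinset)) := by
  obtain ⟨c, hc, C, hC, hmain⟩ := mainTheorem4_general
  refine ⟨c, hc, C, hC, fun G _ _ hG B B' hB hB' _ hBB' α hα₀ A A' hA hA' hαA hαA' => ?_⟩
  rw [← card_twoDilate (by rwa [Nat.card_eq_fintype_card]) A']
  exact hmain G B B' hB hB' hBB' α hα₀ A A' hA hA' hαA hαA'
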